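/- All ideals of $C^*$-algebras are closed and two-sided. For a $C^*$-algebra $\mathcal A$, a nonzero projection $p\in\mathcal A$ is minimal if $p\mathcal Ap=\mathbb Cp$, and $\mathcal I^{At}(\mathcal A)$ denotes the (closed) $*$-subalgebra of $\mathcal A$ generated by the minimal projections; it is an ideal of $\mathcal A$. $\mathcal A$ is scattered if $\mathcal I^{At}(\mathcal B)\neq\{0\}$ for every nonzero $C^*$-subalgebra $\mathcal B\subseteq\mathcal A$. The Cantor–Bendixson sequence of a scattered $\mathcal A$ is the unique strictly increasing sequence of ideals $(\mathcal I_\alpha)_{\alpha\le ht(\mathcal A)}$, continuous at limit ordinals (each limit term is the norm closure of the union of the previous terms), with $\mathcal I_0=\{0\}$, $\mathcal I_{ht(\mathcal A)}=\mathcal A$ and $\mathcal I^{At}(\mathcal A/\mathcal I_\alpha)=\{[a]_{\mathcal I_\alpha}:a\in\mathcal I_{\alpha+1}\}$ for all $\alpha<ht(\mathcal A)$; the ordinal $ht(\mathcal A)$ is the Cantor–Bendixson height. $CCR(\mathcal A)$ is the ideal of all $a\in\mathcal A$ such that $\pi(a)$ is a compact operator for every irreducible representation $\pi$ of $\mathcal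 A$. **Proposition.** Let $\mathcal K(\ell_2)$ be the algebra of compact operators on $\ell_2$, let $\widetilde{\mathcal K(\ell_2)}$ be its unitization, and let $\omega+1$ be the one-point compactification of the countable infinite discrete space. Let $$\mathcal A=C(\omega+1,\widetilde{\mathcal K(\ell_2)})\cong C(\omega+1)\otimes\widetilde{\mathcal K(\ell_2)},$$ where $\otimes$ is the unique $C^*$-tensor product: with the maps $f\otimes b\mapsto f(\cdot)b$, $\mathcal A$ is a $C^*$-completion of the algebraic tensor product, and every other $C^*$-completion of it is $*$-isomorphic to $\mathcal A$ by an isomorphism compatible with the embeddings of the two factors. Then $\mathcal A$ is scattered, it has a Cantor–Bendixson sequence $(\mathcal I_\alpha)_{\alpha\le ht(\mathcal A)}$, its height is $ht(\mathcal A)=3$, and $CCR(\mathcal A)\neq\mathcal I_\alpha$ for every $\alpha\le ht(\mathcal A)$. In particular, there are scattered $C^*$-algebras $\mathcal A$ such that the ideal $CCR(\mathcal A)$ does not appear in the Cantor–Bendixson sequence of $\mathcal A$. -/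

import Mathlib

noncomputable section

/-! ### Minimal projections and scattered C*-algebras -/

section Atoms

variable {A : Type*} [NonUnitalRing A] [StarRing A] [Module ℂ A]

/-- A minimal projection: a nonzero projection `p` with `p A p = ℂ p`. -/
def IsMinimalProjection (p : A) : Prop :=
  p ≠ 0 ∧ IsStarProjection p ∧
    Set.range (fun a : A => p * a * p) = Set.range (fun c : ℂ => c • p)

/-- `I^At(A)`: the closed *-subalgebra generated by the minimal projections (as a subset of `A`).
For a C*-algebra it is a closed two-sided ideal. -/
def atomIdeal (A : Type*) [NonUnitalRing A] [StarRing A] [Module ℂ A] [IsScalarTower ℂ A A]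
    [SMulCommClass ℂ A A] [StarModule ℂ A] [TopologicalSpace A] : Set A :=
  closure (NonUnitalStarAlgebra.adjoin ℂ {p : A | IsMinimalProjection p} : Set A)

end Atoms

/-- A C*-algebra is scattered if `I^At(B) ≠ {0}` for each nonzero C*-subalgebra `B`. -/
def IsScattered (A : Type*) [NonUnitalCStarAlgebra A] : Prop :=
  ∀ B : NonUnitalStarSubalgebra ℂ A, IsClosed (B : Set A) → (∃ b ∈ B, b ≠ 0) →
    atomIdeal B ≠ {0}

/-! ### Closed ideals and their quotients -/

/-- A closed two-sided ideal of a C*-algebra. In a C*-algebra every norm-closed two-sided ideal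
(in the sense of rings) is a linear subspace and is closed under `*`. -/
structure ClosedIdeal (A : Type*) [NonUnitalCStarAlgebra A] extends Submodule ℂ A where
  mul_mem_left' : ∀ (a : A) {x : A}, x ∈ carrier → a * x ∈ carrier
  mul_mem_right' : ∀ (a : A) {x : A}, x ∈ carrier → x * a ∈ carrier
  star_mem' : ∀ {x : A}, x ∈ carrier → star x ∈ carrier
  isClosed' : IsClosed carrier

namespace ClosedIdeal

variable {A : Type*} [NonUnitalCStarAlgebra A]

instance : SetLike (ClosedIdeal A) A where
  coe I := I.carrier
  coe_injective I J h := by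
    cases I; cases J; congr; exact SetLike.coe_injective h

instance : PartialOrder (ClosedIdeal A) := PartialOrder.ofSetLike (ClosedIdeal A) A

/-- The zero ideal. -/
instance : Bot (ClosedIdeal A) where
  bot :=
    { (⊥ : Submodule ℂ A) with
      mul_mem_left' := by
        intro a x (hx : x = 0)
        change a * x = 0
        rw [hx, mul_zero]
      mul_mem_right' := by
        intro a x (hx : x = 0)
        change x * a = 0
        rw [hx, zero_mul]
      star_mem' := by
        intro x (hx : x = 0)
        change star x = 0
        rw [hx, star_zero]
      isClosed' := isClosed_singleton }

/-- The whole algebra. -/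
instance : Top (ClosedIdeal A) where
  top :=
    { (⊤ : Submodule ℂ A) with
      mul_mem_left' := fun _ _ _ => trivial
      mul_mem_right' := fun _ _ _ => trivial
      star_mem' := fun _ => trivial
      isClosed' := isClosed_univ }

theorem mul_sub_mul_mem (I : ClosedIdeal A) {a a' b b' : A} (ha : a - a' ∈ I.toSubmodule)
    (hb : b - b' ∈ I.toSubmodule) : a * b - a' * b' ∈ I.toSubmodule := by
  have h : a * b - a' * b' = (a - a') * b + a' * (b - b') := by
    rw [sub_mul, mul_sub]; abel
  rw [h]
  exact I.toSubmodule.add_mem (I.mul_mem_right' b ha) (I.mul_mem_left' a' hb)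

/-- The quotient `A / I`, with the quotient operations and the quotient topology (the topology of
the quotient norm). -/
def Quot (I : ClosedIdeal A) : Type _ := A ⧸ I.toSubmodule

namespace Quot

variable (I : ClosedIdeal A)

instance : AddCommGroup I.Quot := inferInstanceAs (AddCommGroup (A ⧸ I.toSubmodule))
instance : Module ℂ I.Quot := inferInstanceAs (Module ℂ (A ⧸ I.toSubmodule))
instance : TopologicalSpace I.Quot := inferInstanceAs (TopologicalSpace (A ⧸ I.toSubmodule))

/-- The class `[a]` of `a` in `A / I`. -/
def mk (a : A) : I.Quot := Submodule.Quotient.mk (p := I.toSubmodule) a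

theorem mk_surjective : Function.Surjective (mk I) :=
  Submodule.Quotient.mk_surjective I.toSubmodule

instance : Mul I.Quot where
  mul := Quotient.map₂ (· * ·) (by
    intro a a' ha b b' hb
    exact (Submodule.quotientRel_def _).2 (I.mul_sub_mul_mem
      ((Submodule.quotientRel_def _).1 ha) ((Submodule.quotientRel_def _).1 hb)))

instance : Star I.Quot where
  star := Quotient.map star (by
    intro a a' ha
    refine (Submodule.quotientRel_def _).2 ?_
    rw [← star_sub]
    exact I.star_mem' ((Submodule.quotientRel_def _).1 ha))

@[simp] theorem mk_zero : mk I 0 = 0 := rfl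
@[simp] theorem mk_add (a b : A) : mk I (a + b) = mk I a + mk I b := rfl
@[simp] theorem mk_smul (c : ℂ) (a : A) : mk I (c • a) = c • mk I a := rfl
@[simp] theorem mk_mul (a b : A) : mk I (a * b) = mk I a * mk I b := rfl
@[simp] theorem mk_star (a : A) : mk I (star a) = star (mk I a) := rfl

theorem mk_eq_mk_iff (a b : A) : mk I a = mk I b ↔ a - b ∈ I :=
  Submodule.Quotient.eq I.toSubmodule

instance : NonUnitalRing I.Quot where
  left_distrib := by
    rintro ⟨a⟩ ⟨b⟩ ⟨c⟩
    exact congrArg (mk I) (mul_add a b c)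
  right_distrib := by
    rintro ⟨a⟩ ⟨b⟩ ⟨c⟩
    exact congrArg (mk I) (add_mul a b c)
  zero_mul := by
    rintro ⟨a⟩
    exact congrArg (mk I) (zero_mul a)
  mul_zero := by
    rintro ⟨a⟩
    exact congrArg (mk I) (mul_zero a)
  mul_assoc := by
    rintro ⟨a⟩ ⟨b⟩ ⟨c⟩
    exact congrArg (mk I) (mul_assoc a b c)

instance : StarRing I.Quot where
  star_involutive := by
    rintro ⟨a⟩
    exact congrArg (mk I) (star_star a)
  star_mul := by
    rintro ⟨a⟩ ⟨b⟩
    exact congrArg (mk I) (star_mul a b)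
  star_add := by
    rintro ⟨a⟩ ⟨b⟩
    exact congrArg (mk I) (star_add a b)

instance : StarModule ℂ I.Quot where
  star_smul := by
    rintro c ⟨a⟩
    exact congrArg (mk I) (star_smul c a)

instance : IsScalarTower ℂ I.Quot I.Quot where
  smul_assoc := by
    rintro c ⟨a⟩ ⟨b⟩
    exact congrArg (mk I) (smul_mul_assoc c a b)

instance : SMulCommClass ℂ I.Quot I.Quot where
  smul_comm := by
    rintro c ⟨a⟩ ⟨b⟩
    exact congrArg (mk I) (mul_smul_comm c a b).symm

end Quot

end ClosedIdeal

/-! ### The Cantor–Bendixson sequence -/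

universe u

/-- `(I_α)_{α ≤ θ}` is the Cantor–Bendixson sequence of `A`, and `θ` is the Cantor–Bendixson height:
a continuous strictly increasing sequence of closed ideals with `I_0 = 0`, `I_θ = A` and
`I^At(A / I_α) = {[a] : a ∈ I_{α+1}}` for `α < θ`. (Values of `I` beyond `θ` are irrelevant.) -/
structure IsCantorBendixsonSequence (A : Type u) [NonUnitalCStarAlgebra A] (θ : Ordinal.{u})
    (I : Ordinal.{u} → ClosedIdeal A) : Prop where
  zero : I 0 = ⊥
  top : I θ = ⊤
  strictMono : ∀ α β, α < β → β ≤ θ → I α < I β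
  continuous : ∀ α ≤ θ, Order.IsSuccLimit α →
    (I α : Set A) = closure (⋃ β < α, (I β : Set A))
  derivative : ∀ α < θ,
    atomIdeal (I α).Quot = ClosedIdeal.Quot.mk (I α) '' (I (Order.succ α) : Set A)

/-! ### Compact operators -/

section Compact

variable {H : Type*} [NormedAddCommGroup H] [InnerProductSpace ℂ H] [CompleteSpace H]

theorem isCompactOperator_star {T : H →L[ℂ] H} (hT : IsCompactOperator T) :
    IsCompactOperator (star T : H →L[ℂ] H) := by
  have hS : IsCompactOperator (T * star T) := hT.comp_clm (star T)
  have hK := hS.isCompact_closure_image_ball (f := ((T * star T : H →L[ℂ] H) : H →ₗ[ℂ] H)) 1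
  have hTB : TotallyBounded ((T * star T : H →L[ℂ] H) '' Metric.ball 0 1) :=
    hK.totallyBounded.subset subset_closure
  refine (isCompactOperator_iff_isCompact_closure_image_ball
    ((star T : H →L[ℂ] H) : H →ₗ[ℂ] H) one_pos).2 ?_
  refine TotallyBounded.isCompact_of_isClosed ?_ isClosed_closure
  refine TotallyBounded.closure ?_
  refine Metric.totallyBounded_iff.2 fun ε hε => ?_
  obtain ⟨s, hs, hsf, hcov⟩ := Set.exists_subset_image_finite_and.1
    (Metric.finite_approx_of_totallyBounded hTB (ε ^ 2 / 2) (by positivity))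
  refine ⟨(star T : H →L[ℂ] H) '' s, hsf.image _, ?_⟩
  rintro _ ⟨x, hx, rfl⟩
  have h1 := hcov (Set.mem_image_of_mem _ hx)
  simp only [Set.mem_iUnion, Set.mem_image, exists_prop] at h1
  obtain ⟨_, ⟨y, hy, rfl⟩, hxy⟩ := h1
  simp only [Set.mem_iUnion, Set.mem_image, exists_prop]
  refine ⟨_, ⟨y, hy, rfl⟩, ?_⟩
  rw [Metric.mem_ball, dist_eq_norm] at hxy ⊢
  change ‖star T x - star T y‖ < ε
  rw [← map_sub] at hxy ⊢
  have hyb := hs hy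
  rw [mem_ball_zero_iff] at hyb hx
  have h2 : ‖x - y‖ ≤ 2 := (norm_sub_le _ _).trans (by linarith)
  have h3 : ‖star T (x - y)‖ ^ 2 ≤ ‖(T * star T) (x - y)‖ * ‖x - y‖ := by
    rw [← inner_self_eq_norm_sq (𝕜 := ℂ), ContinuousLinearMap.star_eq_adjoint,
      ContinuousLinearMap.adjoint_inner_right]
    exact (RCLike.re_le_norm _).trans (norm_inner_le_norm _ _)
  have h4 : ‖star T (x - y)‖ ^ 2 < ε ^ 2 := by
    nlinarith [norm_nonneg (x - y), norm_nonneg ((T * star T) (x - y))]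
  exact lt_of_pow_lt_pow_left₀ 2 hε.le h4

variable (H) in
/-- The C*-algebra `K(H)` of compact operators on a complex Hilbert space `H`. -/
def compactOperators : NonUnitalStarSubalgebra ℂ (H →L[ℂ] H) where
  carrier := {T | IsCompactOperator T}
  zero_mem' := isCompactOperator_zero
  add_mem' := fun ha hb => ha.add hb
  mul_mem' := fun {_ b} ha _ => ha.comp_clm b
  smul_mem' := fun c _ ha => ha.smul c
  star_mem' := fun ha => isCompactOperator_star ha

instance compactOperators_isClosed : IsClosed (compactOperators H : Set (H →L[ℂ] H)) :=
  isClosed_setOfPred_isCompactOperator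

end Compact

/-! ### Irreducible representations and the ideal `CCR(A)` -/

/-- A nonzero representation of a C*-algebra on a Hilbert space is irreducible if it has no
nontrivial closed invariant subspace. -/
def IsIrreducibleRep {A : Type*} [NonUnitalCStarAlgebra A] {H : Type*} [NormedAddCommGroup H]
    [InnerProductSpace ℂ H] [CompleteSpace H] (π : A →⋆ₙₐ[ℂ] (H →L[ℂ] H)) : Prop :=
  π ≠ 0 ∧ ∀ S : Submodule ℂ H, IsClosed (S : Set H) → (∀ a, ∀ x ∈ S, π a x ∈ S) → S = ⊥ ∨ S = ⊤

/-- `CCR(A)`: the ideal of all elements which are sent to a compact operator by each irreducible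
representation. (An irreducible representation is cyclic, so up to unitary equivalence its Hilbert
space lives in the universe of `A`.) -/
def ccrIdeal (A : Type u) [NonUnitalCStarAlgebra A] : ClosedIdeal A where
  carrier := {a | ∀ (H : Type u) [NormedAddCommGroup H] [InnerProductSpace ℂ H] [CompleteSpace H]
    (π : A →⋆ₙₐ[ℂ] (H →L[ℂ] H)), IsIrreducibleRep π → IsCompactOperator (π a)}
  zero_mem' := by
    intro H _ _ _ π _
    rw [map_zero]
    exact (compactOperators H).zero_mem
  add_mem' := by
    intro a b ha hb H _ _ _ π h
    rw [map_add]
    exact (compactOperators H).add_mem (ha H π h) (hb H π h)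
  smul_mem' := by
    intro c a ha H _ _ _ π h
    rw [map_smul]
    exact (compactOperators H).smul_mem c (ha H π h)
  mul_mem_left' := by
    intro a x hx H _ _ _ π h
    rw [map_mul]
    exact (hx H π h).clm_comp (π a)
  mul_mem_right' := by
    intro a x hx H _ _ _ π h
    rw [map_mul]
    exact (hx H π h).comp_clm (π a)
  star_mem' := by
    intro x hx H _ _ _ π h
    rw [map_star]
    exact isCompactOperator_star (hx H π h)
  isClosed' := by
    simp only [Set.ofPred_forall]
    refine isClosed_iInter fun H => isClosed_iInter fun _ => isClosed_iInter fun _ =>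
      isClosed_iInter fun _ => isClosed_iInter fun π => isClosed_iInter fun _ => ?_
    have hc : Continuous π :=
      AddMonoidHomClass.continuous_of_bound π 1 fun a => by
        rw [one_mul]; exact NonUnitalStarAlgHom.norm_apply_le π a
    exact (compactOperators_isClosed (H := H)).preimage hc

/-! ### C*-tensor products -/

/-- `T`, with the unital *-homomorphisms `i : a ↦ a ⊗ 1` and `j : b ↦ 1 ⊗ b`, is a C*-tensor product
of the unital C*-algebras `A` and `B`, i.e. a completion of the algebraic tensor product `A ⊗ B` with
respect to some C*-norm: the images commute and the *-homomorphism `a ⊗ b ↦ i a * j b` on the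
algebraic tensor product is injective with dense range. -/
structure IsCStarTensorProduct {A B T : Type*} [CStarAlgebra A] [CStarAlgebra B] [CStarAlgebra T]
    (i : A →⋆ₐ[ℂ] T) (j : B →⋆ₐ[ℂ] T) : Prop where
  commute : ∀ a b, Commute (i a) (j b)
  injective : Function.Injective (Algebra.TensorProduct.lift (i : A →ₐ[ℂ] T) (j : B →ₐ[ℂ] T) commute)
  dense : DenseRange (Algebra.TensorProduct.lift (i : A →ₐ[ℂ] T) (j : B →ₐ[ℂ] T) commute)

/-! ### The algebra -/

/-- The Hilbert space `ℓ₂`. -/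
abbrev EllTwo : Type := lp (fun _ : ℕ => ℂ) 2

/-- The unitization of `K(ℓ₂)`, with its C*-norm. -/
abbrev UnitizedCompacts : Type := Unitization ℂ (compactOperators EllTwo)

/-- `ω + 1`, the one-point compactification of the countable infinite discrete space. -/
abbrev OmegaPlusOne : Type := OnePoint ℕ

/-- The C*-algebra `C(ω + 1, K(ℓ₂)~)` of continuous functions, with pointwise operations and the
supremum norm. -/
abbrev ExampleAlgebra : Type := C(OmegaPlusOne, UnitizedCompacts)

end

/-!
Let `X` be infinite and discrete, `Y` the unitization of `K(H)` for an infinite-dimensional Hilbert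
space `H`, and `σ : Y → ℂ` the character with kernel `K(H)`. A minimal projection of `C(X ∪ {∞}, Y)`
is supported at a point of `X`, so the first derivative consists of the functions which vanish at
`∞` and have values in `ker σ`. Modulo these, the constant functions with value a rank-one
projection and the point masses of `1` become minimal, so the second derivative is
`{f | σ (f ∞) = 0}`, which has codimension one. The ideal `CCR` is `{f | ∀ z, σ (f z) = 0}`: it
contains nonzero constant functions, unlike the derivatives of order at most one, but it does not
contain the point masses of `1`, unlike the derivatives of order two and three.

If a C*-algebra embeds faithfully into compact operators, a nonzero projection of smallest rank is
minimal. With the character `σ` this makes `Y` scattered. A nonzero subalgebra of `C(X ∪ {∞}, Y)` on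
which evaluation at `∞` is not injective has a nonzero ideal of functions supported in a finite
subset of `X`; if this subset is minimal, evaluation at any of its points embeds the ideal into `Y`.

If `f` is made constant off a finite subset `s` of `X`, the resulting function lies in the algebraic
tensor product, where it is the image of `f` under a *-homomorphism of `C(X ∪ {∞}, Y)`. Hence its
norm in any C*-completion is at most `‖f‖`, and `s → X` gives the same bound for `f`.
-/

noncomputable section

open Filter Topology InnerProductSpace ComplexStarModule
open OnePoint hiding map_smul
open scoped CStarAlgebra

section MinimalProjections

variable {A : Type*} [NonUnitalRing A] [StarRing A] [Module ℂ A] [IsScalarTower ℂ A A]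
  [SMulCommClass ℂ A A] {p : A}

theorem isMinimalProjection_iff :
    IsMinimalProjection p ↔ p ≠ 0 ∧ IsStarProjection p ∧ ∀ a, ∃ c : ℂ, p * a * p = c • p := by
  refine and_congr_right fun _ => and_congr_right fun hp => ⟨fun h a => ?_, fun h => ?_⟩
  · obtain ⟨c, hc⟩ := h.subset ⟨a, rfl⟩
    exact ⟨c, hc.symm⟩
  · refine Set.Subset.antisymm ?_ ?_
    · rintro _ ⟨a, rfl⟩
      obtain ⟨c, hc⟩ := h a
      exact ⟨c, hc.symm⟩
    · rintro _ ⟨c, rfl⟩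
      exact ⟨c • p, by simp only [mul_smul_comm, smul_mul_assoc, hp.isIdempotentElem.eq]⟩

theorem isMinimalProjection_of_forall_isSelfAdjoint [StarModule ℂ A] (h0 : p ≠ 0)
    (hp : IsStarProjection p) (h : ∀ a : A, IsSelfAdjoint a → ∃ c : ℂ, p * a * p = c • p) :
    IsMinimalProjection p := by
  refine isMinimalProjection_iff.2 ⟨h0, hp, fun a => ?_⟩
  obtain ⟨c, hc⟩ := h (ℜ a) (ℜ a).2
  obtain ⟨d, hd⟩ := h (ℑ a) (ℑ a).2
  refine ⟨c + Complex.I * d, ?_⟩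
  rw [← realPart_add_I_smul_imaginaryPart a, mul_add, add_mul, hc, mul_smul_comm, smul_mul_assoc,
    hd, smul_smul, add_smul]

namespace IsMinimalProjection

theorem exists_mul_mul_eq_smul (hp : IsMinimalProjection p) (a : A) :
    ∃ c : ℂ, p * a * p = c • p :=
  (isMinimalProjection_iff.1 hp).2.2 a

omit [IsScalarTower ℂ A A] [SMulCommClass ℂ A A] in
theorem mul_self (hp : IsMinimalProjection p) : p * p = p := hp.2.1.isIdempotentElem

theorem of_map {B : Type*} [NonUnitalRing B] [StarRing B] [Module ℂ B] [IsScalarTower ℂ B B]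
    [SMulCommClass ℂ B B] (φ : A →⋆ₙₐ[ℂ] B) (hφ : Function.Injective φ)
    (hp : IsMinimalProjection (φ p)) : IsMinimalProjection p := by
  refine isMinimalProjection_iff.2 ⟨fun h => hp.1 (by rw [h, map_zero]),
    ⟨hφ (by rw [map_mul, hp.mul_self]), hφ (by rw [map_star, hp.2.1.isSelfAdjoint.star_eq])⟩,
    fun a => ?_⟩
  obtain ⟨c, hc⟩ := hp.exists_mul_mul_eq_smul (φ a)
  exact ⟨c, hφ (by rw [map_mul, map_mul, map_smul, hc])⟩

end IsMinimalProjection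

end MinimalProjections

section StarKer

variable {A B : Type*} [NonUnitalCStarAlgebra A] [NonUnitalCStarAlgebra B]

/-- The kernel of a *-homomorphism of C*-algebras, as a *-subalgebra of its domain. -/
def starKer (φ : A →⋆ₙₐ[ℂ] B) : NonUnitalStarSubalgebra ℂ A :=
  NonUnitalStarSubalgebra.comap φ ⊥

theorem mem_starKer {φ : A →⋆ₙₐ[ℂ] B} {a : A} : a ∈ starKer φ ↔ φ a = 0 :=
  NonUnitalStarAlgebra.mem_bot

instance isClosed_starKer (φ : A →⋆ₙₐ[ℂ] B) : IsClosed (starKer φ : Set A) := by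
  have : (starKer φ : Set A) = φ ⁻¹' {0} := Set.ext fun _ => mem_starKer
  exact this ▸ isClosed_singleton.preimage (map_continuous φ)

theorem nontrivial_starKer {φ : A →⋆ₙₐ[ℂ] B} (hφ : ¬ Function.Injective φ) :
    Nontrivial (starKer φ) := by
  rw [injective_iff_map_eq_zero] at hφ
  push Not at hφ
  obtain ⟨a, ha, ha0⟩ := hφ
  exact ⟨⟨a, mem_starKer.2 ha⟩, 0, fun h => ha0 (congrArg Subtype.val h)⟩

theorem IsMinimalProjection.coe_starKer {φ : A →⋆ₙₐ[ℂ] B} {p : starKer φ}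
    (hp : IsMinimalProjection p) : IsMinimalProjection (p : A) := by
  have hpp : (p : A) * p = p := congrArg Subtype.val hp.mul_self
  refine isMinimalProjection_iff.2 ⟨fun h => hp.1 (Subtype.ext h),
    ⟨hpp, congrArg Subtype.val hp.2.1.isSelfAdjoint.star_eq⟩, fun a => ?_⟩
  have hmem : (p : A) * a * p ∈ starKer φ :=
    mem_starKer.2 (by rw [map_mul, mem_starKer.1 p.2, mul_zero])
  obtain ⟨c, hc⟩ := hp.exists_mul_mul_eq_smul ⟨_, hmem⟩
  have hc' : (p : A) * (p * a * p) * p = c • (p : A) := congrArg Subtype.val hc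
  exact ⟨c, by rw [← hc', mul_assoc (p : A) a, ← mul_assoc (p : A) p, hpp, mul_assoc, mul_assoc,
    hpp]⟩

end StarKer

section Scattered

variable {A B C : Type*} [NonUnitalCStarAlgebra A] [NonUnitalCStarAlgebra B]
  [NonUnitalCStarAlgebra C]

theorem atomIdeal_ne_singleton_zero_iff {A : Type*} [NonUnitalRing A] [StarRing A] [Module ℂ A]
    [IsScalarTower ℂ A A] [SMulCommClass ℂ A A] [StarModule ℂ A] [TopologicalSpace A] [T1Space A] :
    atomIdeal A ≠ {0} ↔ ∃ p : A, IsMinimalProjection p := by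
  refine ⟨fun h => ?_, fun ⟨p, hp⟩ h => hp.1 ?_⟩
  · by_contra! hp
    refine h ?_
    have hbot : NonUnitalStarAlgebra.adjoin ℂ {p : A | IsMinimalProjection p} = ⊥ :=
      le_bot_iff.1 (NonUnitalStarAlgebra.adjoin_le fun p h => (hp p h).elim)
    rw [atomIdeal, hbot, NonUnitalStarAlgebra.coe_bot, closure_singleton]
  · exact h.subset (subset_closure (NonUnitalStarAlgebra.subset_adjoin ℂ _ hp))

theorem isScattered_of_forall_subalgebra
    (h : ∀ S : NonUnitalStarSubalgebra ℂ A, IsClosed (S : Set A) → Nontrivial S →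
      ∃ p : S, IsMinimalProjection p) : IsScattered A := by
  rintro S hS ⟨b, hb, hb0⟩
  exact atomIdeal_ne_singleton_zero_iff.2
    (h S hS ⟨⟨b, hb⟩, 0, fun h => hb0 (congrArg Subtype.val h)⟩)

namespace IsScattered

theorem exists_isMinimalProjection [Nontrivial A] (hB : IsScattered B) (φ : A →⋆ₙₐ[ℂ] B)
    (hφ : Function.Injective φ) : ∃ p : A, IsMinimalProjection p := by
  obtain ⟨a, ha⟩ := exists_ne (0 : A)
  have hclosed : IsClosed (NonUnitalStarAlgHom.range φ : Set B) := by
    rw [NonUnitalStarAlgHom.coe_range]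
    exact (NonUnitalStarAlgHom.isometry φ hφ).isClosedEmbedding.isClosed_range
  obtain ⟨⟨_, p, rfl⟩, hp⟩ := atomIdeal_ne_singleton_zero_iff.1 (hB _ hclosed
    ⟨φ a, ⟨a, rfl⟩, (map_ne_zero_iff φ hφ).2 ha⟩)
  exact ⟨p, hp.of_map (NonUnitalStarAlgHom.rangeRestrict φ)
    fun x y h => hφ (congrArg Subtype.val h)⟩

theorem exists_isMinimalProjection_of_starKer {φ : A →⋆ₙₐ[ℂ] B} (hφ : ¬ Function.Injective φ)
    (hC : IsScattered C) (ψ : starKer φ →⋆ₙₐ[ℂ] C) (hψ : Function.Injective ψ) :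
    ∃ p : A, IsMinimalProjection p :=
  have := nontrivial_starKer hφ
  have ⟨p, hp⟩ := hC.exists_isMinimalProjection ψ hψ
  ⟨p, hp.coe_starKer⟩

theorem of_starKer (φ : A →⋆ₙₐ[ℂ] B) (hB : IsScattered B) (hker : IsScattered (starKer φ)) :
    IsScattered A := by
  refine isScattered_of_forall_subalgebra fun S hS _ => ?_
  let ι : S →⋆ₙₐ[ℂ] A := NonUnitalStarSubalgebraClass.subtype S
  by_cases hinj : Function.Injective (φ.comp ι)
  · exact hB.exists_isMinimalProjection _ hinj
  · exact hker.exists_isMinimalProjection_of_starKer hinj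
      (NonUnitalStarAlgHom.codRestrict
        (ι.comp (NonUnitalStarSubalgebraClass.subtype (starKer (φ.comp ι)))) (starKer φ)
        fun a => mem_starKer.2 (mem_starKer.1 a.2))
      ((NonUnitalStarAlgHom.injective_codRestrict _ _ _).2
        (Subtype.val_injective.comp Subtype.val_injective))

end IsScattered

theorem isScattered_complex : IsScattered ℂ := by
  refine isScattered_of_forall_subalgebra fun S _ _ => ?_
  obtain ⟨b, hb⟩ := exists_ne (0 : S)
  have hb0 : (b : ℂ) ≠ 0 := fun h => hb (Subtype.ext h)
  have h1 : (1 : ℂ) ∈ S := by simpa [hb0] using S.smul_mem (b : ℂ)⁻¹ b.2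
  refine ⟨⟨1, h1⟩, isMinimalProjection_iff.2
    ⟨fun h => one_ne_zero (congrArg Subtype.val h), ⟨Subtype.ext (one_mul 1),
      Subtype.ext (star_one ℂ)⟩, fun a => ⟨a, Subtype.ext ?_⟩⟩⟩
  change 1 * (a : ℂ) * 1 = a * 1
  rw [one_mul]

end Scattered

section CompactSpectrum

open Module.End

variable {H : Type*} [NormedAddCommGroup H] [InnerProductSpace ℂ H] [CompleteSpace H]
  {T : H →L[ℂ] H}

theorem eq_zero_of_comp_starProjection_orthogonal_eigenspace (hT : T.IsSymmetric) {r : ℂ}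
    (hr : r ≠ 0) {x : H}
    (hx : T ((eigenspace (T : H →ₗ[ℂ] H) r)ᗮ.starProjection x) = r • x) : x = 0 := by
  set E := eigenspace (T : H →ₗ[ℂ] H) r
  have hxE : x ∈ Eᗮ := by
    rw [← inv_smul_smul₀ hr x, ← hx]
    exact Eᗮ.smul_mem _ (hT.invariant_orthogonalComplement_eigenspace r _
      (Submodule.starProjection_apply_mem _ _))
  rw [Submodule.starProjection_eq_self_iff.2 hxE] at hx
  exact (Submodule.isOrtho_orthogonal_right E).disjoint.le_bot ⟨mem_eigenspace_iff.2 hx, hxE⟩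

theorem eventually_notMem_spectrum_of_isCompactOperator (hTc : IsCompactOperator T)
    (hT : T.IsSymmetric) {r : ℂ} (hr : r ≠ 0) : ∀ᶠ s in 𝓝[≠] r, s ∉ spectrum ℂ T := by
  set E := eigenspace (T : H →ₗ[ℂ] H) r
  -- `S` has the eigenvectors of `T` for the eigenvalues other than `r`, but not `r` as eigenvalue
  set S : H →L[ℂ] H := T ∘L Eᗮ.starProjection
  have hSc : IsCompactOperator S := hTc.comp_clm _
  have hrS : r ∉ spectrum ℂ S := by
    rw [← hSc.hasEigenvalue_iff_mem_spectrum hr]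
    intro h
    obtain ⟨x, hx⟩ := h.exists_hasEigenvector
    exact hx.2 (eq_zero_of_comp_starProjection_orthogonal_eigenspace hT hr hx.apply_eq_smul)
  have hev : ∀ᶠ s in 𝓝 r, s ∉ spectrum ℂ S := (spectrum.isClosed S).isOpen_compl.mem_nhds hrS
  filter_upwards [nhdsWithin_le_nhds hev, nhdsWithin_le_nhds (isOpen_ne.mem_nhds hr),
    self_mem_nhdsWithin] with s hsS hs0 hsr hsT
  rw [← hTc.hasEigenvalue_iff_mem_spectrum hs0] at hsT
  rw [← hSc.hasEigenvalue_iff_mem_spectrum hs0] at hsS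
  obtain ⟨x, hx⟩ := hsT.exists_hasEigenvector
  have hxE : x ∈ Eᗮ := (Submodule.mem_orthogonal _ _).2 fun y hy =>
    hT.orthogonalFamily_eigenspaces (Ne.symm hsr) ⟨y, hy⟩ ⟨x, hx.1⟩
  refine hsS (hasEigenvalue_of_hasEigenvector (x := x) ⟨mem_eigenspace_iff.2 ?_, hx.2⟩)
  change T (Eᗮ.starProjection x) = s • x
  rw [Submodule.starProjection_eq_self_iff.2 hxE]
  exact hx.apply_eq_smul

theorem exists_continuous_forall_mem_quasispectrum_eq_or_eq_zero (hTc : IsCompactOperator T)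
    (hT : IsSelfAdjoint T) {r : ℝ} (hr : r ≠ 0) :
    ∃ f : ℝ → ℝ, Continuous f ∧ f 0 = 0 ∧ f r = 1 ∧
      ∀ s ∈ quasispectrum ℝ T, s = r ∨ f s = 0 := by
  obtain ⟨ε, hε, hiso⟩ := Metric.mem_nhdsWithin_iff.1
    (eventually_notMem_spectrum_of_isCompactOperator hTc
      (ContinuousLinearMap.isSelfAdjoint_iff_isSymmetric.1 hT) (Complex.ofReal_ne_zero.2 hr))
  set δ := min ε |r|
  have hδ : 0 < δ := lt_min hε (abs_pos.2 hr)
  let f : ℝ → ℝ := fun s => max 0 (1 - |s - r| / δ)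
  have hf : ∀ {s}, δ ≤ |s - r| → f s = 0 := fun h =>
    max_eq_left (sub_nonpos.2 ((one_le_div hδ).2 h))
  have hf0 : f 0 = 0 := hf (by simpa only [zero_sub, abs_neg] using min_le_right ε |r|)
  refine ⟨f, by fun_prop, hf0, by simp [f], fun s hs => ?_⟩
  rw [quasispectrum_eq_spectrum_union_zero] at hs
  rcases hs with hs | rfl
  · by_contra! hne
    have hsr : |s - r| < δ := not_le.1 (mt hf hne.2)
    refine hiso ⟨?_, Complex.ofReal_injective.ne hne.1⟩ ((spectrum.algebraMap_mem_iff ℂ).2 hs)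
    rw [Metric.mem_ball, Complex.dist_eq, ← Complex.ofReal_sub, Complex.norm_real]
    exact hsr.trans_le (min_le_left _ _)
  · exact .inr hf0

theorem finiteDimensional_range_of_isCompactOperator (hTc : IsCompactOperator T)
    (hT : T * T = T) : FiniteDimensional ℂ (LinearMap.range (T : H →ₗ[ℂ] H)) := by
  have := ContinuousLinearMap.finite_dimensional_eigenspace hTc 1 one_ne_zero
  refine Submodule.finiteDimensional_of_le (S₂ := eigenspace (T : H →ₗ[ℂ] H) 1) ?_
  rintro _ ⟨x, rfl⟩
  rw [mem_eigenspace_iff, one_smul]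
  exact congrArg (fun R : H →L[ℂ] H => R x) hT

end CompactSpectrum

section CompactRepresentation

variable {A : Type*} [NonUnitalCStarAlgebra A] {H : Type*} [NormedAddCommGroup H]
  [InnerProductSpace ℂ H] [CompleteSpace H] {ρ : A →⋆ₙₐ[ℂ] (H →L[ℂ] H)}

theorem exists_isStarProjection_mul_eq_smul (hρ : Function.Injective ρ)
    (hc : ∀ a, IsCompactOperator (ρ a)) {a : A} (ha : IsSelfAdjoint a) (ha0 : a ≠ 0) :
    ∃ (r : ℝ) (q : A), r ≠ 0 ∧ q ≠ 0 ∧ IsStarProjection q ∧ a * q = r • q := by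
  have hρa : IsSelfAdjoint (ρ a) := ha.map ρ
  obtain ⟨r, hrσ, hr⟩ : ∃ r ∈ quasispectrum ℝ (ρ a), r ≠ 0 := by
    by_contra! h
    exact ha0 (hρ (by rw [map_zero,
      CFC.eq_zero_of_quasispectrum_eq_zero (R := ℝ) (ρ a) (fun r hr => h r hr) hρa]))
  obtain ⟨f, hf, hf0, hfr, hfσ⟩ :=
    exists_continuous_forall_mem_quasispectrum_eq_or_eq_zero (hc a) hρa hr
  have hq : ρ (cfcₙ f a) = cfcₙ f (ρ a) :=
    NonUnitalStarAlgHom.map_cfcₙ ρ f a hf.continuousOn hf0 (map_continuous ρ) ha hρa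
  refine ⟨r, cfcₙ f a, hr, fun h => ?_, ⟨hρ ?_, cfcₙ_predicate f a⟩, hρ ?_⟩
  · have := norm_apply_le_norm_cfcₙ f (ρ a) hrσ hf.continuousOn hf0 hρa
    rw [← hq, h, map_zero, norm_zero, hfr, norm_one] at this
    exact absurd this (not_le.2 one_pos)
  · rw [map_mul, hq, ← cfcₙ_mul f f (ρ a) hf.continuousOn hf0 hf.continuousOn hf0]
    refine cfcₙ_congr fun s hs => ?_
    rcases hfσ s hs with rfl | h
    · simp only [hfr, mul_one]
    · simp only [h, mul_zero]
  · rw [map_mul, ← Complex.coe_smul r, map_smul, Complex.coe_smul, hq,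
      ← cfcₙ_const_mul r f (ρ a) hf.continuousOn hf0]
    nth_rewrite 1 [← cfcₙ_id' ℝ (ρ a)]
    rw [← cfcₙ_mul (fun s => s) f (ρ a) continuousOn_id rfl hf.continuousOn hf0]
    refine cfcₙ_congr fun s hs => ?_
    rcases hfσ s hs with rfl | h
    · rfl
    · simp only [h, mul_zero]

/-- The dimension of the range of `ρ a`. It is used for compact `ρ p` with `p` a projection, where
this range is finite-dimensional. -/
def repRank (ρ : A →⋆ₙₐ[ℂ] (H →L[ℂ] H)) (a : A) : ℕ :=
  Module.finrank ℂ (LinearMap.range (ρ a : H →ₗ[ℂ] H))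

theorem eq_of_mul_eq_of_repRank_le (hρ : Function.Injective ρ) {p q : A}
    (hc : IsCompactOperator (ρ p)) (hp : IsStarProjection p) (hq : IsStarProjection q)
    (hpq : p * q = q) (hle : repRank ρ p ≤ repRank ρ q) : p = q := by
  have hidem : ∀ {e : A}, IsStarProjection e → ρ e * ρ e = ρ e := fun he => by
    rw [← map_mul, he.isIdempotentElem.eq]
  have := finiteDimensional_range_of_isCompactOperator hc (hidem hp)
  have hrange : LinearMap.range (ρ q : H →ₗ[ℂ] H) = LinearMap.range (ρ p : H →ₗ[ℂ] H) := by
    refine Submodule.eq_of_le_of_finrank_le ?_ hle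
    rintro _ ⟨x, rfl⟩
    refine ⟨ρ q x, ?_⟩
    change (ρ p * ρ q) x = ρ q x
    rw [← map_mul, hpq]
  have hqp : q * p = p := by
    refine hρ (ContinuousLinearMap.ext fun x => ?_)
    obtain ⟨y, hy⟩ : ρ p x ∈ LinearMap.range (ρ q : H →ₗ[ℂ] H) := hrange ▸ ⟨x, rfl⟩
    change ρ q y = ρ p x at hy
    rw [map_mul, mul_apply_eq_comp, ← hy]
    exact congrArg (fun R : H →L[ℂ] H => R y) (hidem hq)
  have h := congrArg star hqp
  rwa [star_mul, hp.isSelfAdjoint.star_eq, hq.isSelfAdjoint.star_eq, hpq, eq_comm] at h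

theorem exists_isMinimalProjection_of_isCompactOperator [Nontrivial A] (hρ : Function.Injective ρ)
    (hc : ∀ a, IsCompactOperator (ρ a)) : ∃ p : A, IsMinimalProjection p := by
  have hne : ∃ n, ∃ p : A, (p ≠ 0 ∧ IsStarProjection p) ∧ repRank ρ p = n := by
    obtain ⟨a, ha⟩ := exists_ne (0 : A)
    obtain ⟨-, q, -, hq0, hq, -⟩ := exists_isStarProjection_mul_eq_smul hρ hc
      (IsSelfAdjoint.star_mul_self a) ((CStarRing.star_mul_self_eq_zero_iff a).not.2 ha)
    exact ⟨_, q, ⟨hq0, hq⟩, rfl⟩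
  classical
  obtain ⟨p, ⟨hp0, hp⟩, hpn⟩ := Nat.find_spec hne
  have hmin : ∀ q : A, q ≠ 0 → IsStarProjection q → repRank ρ p ≤ repRank ρ q := fun q hq0 hq =>
    hpn.trans_le (Nat.find_min' hne ⟨q, ⟨hq0, hq⟩, rfl⟩)
  refine ⟨p, isMinimalProjection_of_forall_isSelfAdjoint hp0 hp fun a ha => ?_⟩
  by_cases ha0 : p * a * p = 0
  · exact ⟨0, by rw [ha0, zero_smul]⟩
  have hpap : IsSelfAdjoint (p * a * p) := by
    simpa only [hp.isSelfAdjoint.star_eq] using ha.conjugate p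
  obtain ⟨r, q, hr, hq0, hq, hrq⟩ := exists_isStarProjection_mul_eq_smul hρ hc hpap ha0
  have hpq : p * q = q := by
    rw [← inv_smul_smul₀ hr q, ← hrq, mul_smul_comm, ← mul_assoc, ← mul_assoc, ← mul_assoc,
      hp.isIdempotentElem.eq]
  obtain rfl : p = q := eq_of_mul_eq_of_repRank_le hρ (hc p) hp hq hpq (hmin q hq0 hq)
  rw [mul_assoc _ p p, hp.isIdempotentElem.eq] at hrq
  exact ⟨r, by rw [hrq, Complex.coe_smul]⟩

theorem isScattered_of_isCompactOperator (hρ : Function.Injective ρ)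
    (hc : ∀ a, IsCompactOperator (ρ a)) : IsScattered A :=
  isScattered_of_forall_subalgebra fun S _ _ =>
    exists_isMinimalProjection_of_isCompactOperator
      (ρ := ρ.comp (NonUnitalStarSubalgebraClass.subtype S)) (hρ.comp Subtype.val_injective)
      fun a => hc a

end CompactRepresentation

section OnePointFunctions

variable {X Y : Type*} [TopologicalSpace X]

/-- Evaluation at a point, as a *-homomorphism; Mathlib's `ContinuousMap.evalStarAlgHom` is
restricted to commutative algebras. -/
def evalHom [CStarAlgebra Y] (z : X) : C(X, Y) →⋆ₙₐ[ℂ] Y where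
  toFun f := f z
  map_smul' _ _ := rfl
  map_zero' := rfl
  map_add' _ _ := rfl
  map_mul' _ _ := rfl
  map_star' _ := rfl

variable [DiscreteTopology X]

open Classical in
/-- The self-map of `OnePoint X` which sends the points of `s` to `∞` and fixes all others. -/
def collapseToInfty (s : Set X) : C(OnePoint X, OnePoint X) :=
  continuousMapMkDiscrete (fun x => if x ∈ s then ∞ else (x : OnePoint X)) ∞ <|
    tendsto_const_nhds.if
      (((continuous_iff_from_discrete _).1 continuous_id).mono_left inf_le_left)

theorem collapseToInfty_infty (s : Set X) : collapseToInfty s ∞ = ∞ := rfl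

theorem collapseToInfty_of_mem {s : Set X} {x : X} (hx : x ∈ s) : collapseToInfty s x = ∞ :=
  if_pos hx

theorem collapseToInfty_of_notMem {s : Set X} {x : X} (hx : x ∉ s) : collapseToInfty s x = x :=
  if_neg hx

theorem collapseToInfty_empty : collapseToInfty (∅ : Set X) = .id (OnePoint X) := by
  ext z
  induction z using OnePoint.rec with
  | infty => rfl
  | coe x => exact collapseToInfty_of_notMem (Set.notMem_empty x)

variable [CStarAlgebra Y]

theorem tendsto_comp_collapseToInfty_compl (f : C(OnePoint X, Y)) :
    Tendsto (fun s : Finset X => f.comp (collapseToInfty (s : Set X)ᶜ)) atTop (𝓝 f) := by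
  refine Metric.tendsto_nhds.2 fun ε hε => ?_
  have hfin := (continuous_iff_from_discrete _).1 f.continuous (Metric.ball_mem_nhds (f ∞) hε)
  filter_upwards [eventually_ge_atTop hfin.toFinset] with s hs
  refine (ContinuousMap.dist_lt_iff hε).2 fun z => ?_
  rw [ContinuousMap.comp_apply]
  induction z using OnePoint.rec with
  | infty => rwa [collapseToInfty_infty, dist_self]
  | coe x =>
    by_cases hx : x ∈ s
    · rwa [collapseToInfty_of_notMem (by simpa using hx), dist_self]
    · rw [collapseToInfty_of_mem (by simpa using hx), dist_comm]
      by_contra h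
      exact hx (hs (hfin.mem_toFinset.2 h))

theorem comp_collapseToInfty_diff_singleton_eq_zero {f : C(OnePoint X, Y)} {s : Set X} {x : X}
    (hf : f.comp (collapseToInfty s) = 0) (hx : f x = 0) :
    f.comp (collapseToInfty (s \ {x})) = 0 := by
  ext z
  have hfz := DFunLike.congr_fun hf z
  have hf' : f ∞ = 0 := DFunLike.congr_fun hf ∞
  rw [ContinuousMap.comp_apply, ContinuousMap.zero_apply] at hfz ⊢
  induction z using OnePoint.rec with
  | infty => exact hf'
  | coe y =>
    by_cases hy : y ∈ s \ {x}
    · rw [collapseToInfty_of_mem hy, hf']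
    rw [collapseToInfty_of_notMem hy]
    rcases eq_or_ne y x with rfl | hne
    · exact hx
    · rwa [collapseToInfty_of_notMem fun h => hy ⟨h, hne⟩] at hfz

theorem exists_norm_comp_collapseToInfty_lt {f : C(OnePoint X, Y)} (hf : f ≠ 0)
    (hf' : f ∞ = 0) : ∃ s : Finset X, ‖f.comp (collapseToInfty (s : Set X))‖ < ‖f‖ := by
  have hsplit : ∀ s : Set X, f.comp (collapseToInfty s) = f - f.comp (collapseToInfty sᶜ) := by
    intro s
    ext z
    simp only [ContinuousMap.comp_apply, ContinuousMap.sub_apply]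
    induction z using OnePoint.rec with
    | infty => simp only [collapseToInfty_infty, hf', sub_zero]
    | coe x =>
      by_cases hx : x ∈ s
      · rw [collapseToInfty_of_mem hx, collapseToInfty_of_notMem (not_not.2 hx), hf', sub_self]
      · rw [collapseToInfty_of_notMem hx, collapseToInfty_of_mem hx, hf', sub_zero]
  have hlim : Tendsto (fun s : Finset X => ‖f.comp (collapseToInfty (s : Set X))‖) atTop
      (𝓝 0) := by
    have h := ((tendsto_comp_collapseToInfty_compl f).const_sub f).norm
    rw [sub_self, norm_zero] at h
    exact h.congr fun s => by rw [← hsplit]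
  exact (hlim.eventually_lt_const (norm_pos_iff.2 hf)).exists

open Classical in
/-- The *-homomorphism sending `b` to the function with value `b` at `x` and `0` elsewhere. -/
def pointMass (x : X) : Y →⋆ₙₐ[ℂ] C(OnePoint X, Y) where
  toFun b := ⟨Pi.single (x : OnePoint X) b, (continuous_iff_from_discrete _).2 <|
    tendsto_nhds_of_eventually_eq <| (eventually_cofinite_ne x).mono fun y hy => by
      rw [Pi.single_eq_of_ne (coe_injective.ne hy), Pi.single_eq_of_ne (infty_ne_coe x)]⟩
  map_smul' c b := DFunLike.coe_injective (Pi.single_smul (f := fun _ => Y) (x : OnePoint X) c b)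
  map_zero' := DFunLike.coe_injective (Pi.single_zero (M := fun _ => Y) (x : OnePoint X))
  map_add' b c := DFunLike.coe_injective (Pi.single_add (f := fun _ => Y) (x : OnePoint X) b c)
  map_mul' b c := DFunLike.coe_injective (Pi.single_mul (α := fun _ => Y) (x : OnePoint X) b c)
  map_star' b := DFunLike.coe_injective (Pi.single_star (f := fun _ => Y) (x : OnePoint X) b)

open Classical in
theorem pointMass_apply_self (x : X) (b : Y) : pointMass x b x = b :=
  Pi.single_eq_same (M := fun _ => Y) (x : OnePoint X) b

open Classical in
theorem pointMass_apply_of_ne {x : X} {z : OnePoint X} (h : z ≠ x) (b : Y) :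
    pointMass x b z = 0 :=
  Pi.single_eq_of_ne (M := fun _ => Y) h b

theorem pointMass_apply_infty (x : X) (b : Y) : pointMass x b ∞ = 0 :=
  pointMass_apply_of_ne (infty_ne_coe x) b

theorem mul_pointMass (f : C(OnePoint X, Y)) (x : X) (b : Y) :
    f * pointMass x b = pointMass x (f x * b) := by
  ext z
  rcases eq_or_ne z x with rfl | hz
  · rw [ContinuousMap.mul_apply, pointMass_apply_self, pointMass_apply_self]
  · rw [ContinuousMap.mul_apply, pointMass_apply_of_ne hz, pointMass_apply_of_ne hz, mul_zero]

theorem pointMass_mul (f : C(OnePoint X, Y)) (x : X) (b : Y) :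
    pointMass x b * f = pointMass x (b * f x) := by
  ext z
  rcases eq_or_ne z x with rfl | hz
  · rw [ContinuousMap.mul_apply, pointMass_apply_self, pointMass_apply_self]
  · rw [ContinuousMap.mul_apply, pointMass_apply_of_ne hz, pointMass_apply_of_ne hz, zero_mul]

theorem comp_collapseToInfty_compl_eq (f : C(OnePoint X, Y)) (s : Finset X) :
    f.comp (collapseToInfty (s : Set X)ᶜ) =
      ContinuousMap.const (OnePoint X) (f ∞) + ∑ x ∈ s, pointMass x (f x - f ∞) := by
  ext z
  rw [ContinuousMap.comp_apply, ContinuousMap.add_apply, ContinuousMap.sum_apply,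
    ContinuousMap.const_apply]
  induction z using OnePoint.rec with
  | infty =>
    rw [collapseToInfty_infty, Finset.sum_eq_zero fun x _ => pointMass_apply_infty x _, add_zero]
  | coe y =>
    have hne : ∀ x ≠ y, pointMass x (f x - f ∞) y = 0 := fun x hx =>
      pointMass_apply_of_ne (coe_injective.ne hx.symm) _
    by_cases hy : y ∈ s
    · rw [collapseToInfty_of_notMem (by simpa using hy), Finset.sum_eq_single_of_mem y hy
        fun x _ hx => hne x hx, pointMass_apply_self, add_sub_cancel]
    · rw [collapseToInfty_of_mem (by simpa using hy), Finset.sum_eq_zero fun x hx =>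
        hne x (ne_of_mem_of_not_mem hx hy), add_zero]

theorem mem_of_const_mem_of_pointMass_mem {𝒮 : Type*} [SetLike 𝒮 C(OnePoint X, Y)]
    [AddSubmonoidClass 𝒮 C(OnePoint X, Y)] {S : 𝒮} (hS : IsClosed (S : Set C(OnePoint X, Y)))
    {f : C(OnePoint X, Y)} (hconst : ContinuousMap.const (OnePoint X) (f ∞) ∈ S)
    (hpoint : ∀ x : X, pointMass x (f x - f ∞) ∈ S) : f ∈ S :=
  hS.mem_of_tendsto (tendsto_comp_collapseToInfty_compl f) <| Eventually.of_forall fun s => by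
    rw [comp_collapseToInfty_compl_eq]
    exact add_mem hconst (sum_mem fun x _ => hpoint x)

theorem IsScattered.continuousMap_onePoint (hY : IsScattered Y) :
    IsScattered C(OnePoint X, Y) := by
  refine isScattered_of_forall_subalgebra fun S _ _ => ?_
  let ev (z : OnePoint X) : S →⋆ₙₐ[ℂ] Y :=
    (evalHom z).comp (NonUnitalStarSubalgebraClass.subtype S)
  let col (s : Finset X) : S →⋆ₙₐ[ℂ] C(OnePoint X, Y) :=
    NonUnitalStarAlgHom.comp (ContinuousMap.compStarAlgHom' ℂ Y (collapseToInfty (s : Set X)))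
      (NonUnitalStarSubalgebraClass.subtype S)
  by_cases hinfty : Function.Injective (ev ∞)
  · exact hY.exists_isMinimalProjection _ hinfty
  have hcol : ∃ s, ¬ Function.Injective (col s) := by
    rw [injective_iff_map_eq_zero] at hinfty
    push Not at hinfty
    obtain ⟨f, hf, hf0⟩ := hinfty
    obtain ⟨s, hs⟩ := exists_norm_comp_collapseToInfty_lt (f := f.1)
      (fun h => hf0 (Subtype.ext h)) hf
    exact ⟨s, fun hinj => hs.ne (NonUnitalStarAlgHom.norm_map (col s) hinj f)⟩
  -- the nonzero functions in `S` that vanish off the finite set `s` are not supported in a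
  -- smaller set, so they are determined by their value at any point of `s`
  obtain ⟨s, hs, hmin⟩ := exists_minimal_of_wellFoundedLT _ hcol
  obtain ⟨x, hx⟩ : s.Nonempty := by
    rw [Finset.nonempty_iff_ne_empty]
    rintro rfl
    refine hs fun f g hfg => Subtype.ext ?_
    simp only [col, Finset.coe_empty, collapseToInfty_empty] at hfg
    exact hfg
  refine hY.exists_isMinimalProjection_of_starKer hs
    ((ev x).comp (NonUnitalStarSubalgebraClass.subtype (starKer (col s))))
    ((injective_iff_map_eq_zero _).2 fun f hfx => ?_)
  classical
  have herase : Function.Injective (col (s.erase x)) := by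
    by_contra h
    exact Finset.notMem_erase x s (hmin h (s.erase_subset x) hx)
  refine Subtype.ext ((injective_iff_map_eq_zero _).1 herase _ ?_)
  have hf : f.1.1.comp (collapseToInfty (s : Set X)) = 0 := mem_starKer.1 f.2
  have h := comp_collapseToInfty_diff_singleton_eq_zero hf hfx
  rwa [← Finset.coe_erase] at h

end OnePointFunctions

section Quotients

theorem IsMinimalProjection.mem_atomIdeal {A : Type*} [NonUnitalRing A] [StarRing A] [Module ℂ A]
    [IsScalarTower ℂ A A] [SMulCommClass ℂ A A] [StarModule ℂ A] [TopologicalSpace A] {p : A}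
    (hp : IsMinimalProjection p) : p ∈ atomIdeal A :=
  subset_closure (NonUnitalStarAlgebra.subset_adjoin ℂ _ hp)

theorem atomIdeal_subset {A : Type*} [NonUnitalRing A] [StarRing A] [Module ℂ A]
    [IsScalarTower ℂ A A] [SMulCommClass ℂ A A] [StarModule ℂ A] [TopologicalSpace A]
    {S : NonUnitalStarSubalgebra ℂ A} (hS : IsClosed (S : Set A))
    (h : ∀ p, IsMinimalProjection p → p ∈ S) : atomIdeal A ⊆ S :=
  closure_minimal (NonUnitalStarAlgebra.adjoin_le h) hS

namespace ClosedIdeal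

variable {A : Type*} [NonUnitalCStarAlgebra A] (I J : ClosedIdeal A)

/-- A closed ideal, as a *-subalgebra. -/
def toStarSubalgebra : NonUnitalStarSubalgebra ℂ A where
  __ := J.toSubmodule
  mul_mem' {a _} _ hb := J.mul_mem_left' a hb
  star_mem' ha := J.star_mem' ha

/-- The kernel of a *-homomorphism, as a closed ideal of its domain. -/
def ker {B : Type*} [NonUnitalCStarAlgebra B] (φ : A →⋆ₙₐ[ℂ] B) : ClosedIdeal A where
  __ := (starKer φ).toSubmodule
  mul_mem_left' a x hx := mem_starKer.2 (by rw [map_mul, mem_starKer.1 hx, mul_zero])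
  mul_mem_right' a x hx := mem_starKer.2 (by rw [map_mul, mem_starKer.1 hx, zero_mul])
  star_mem' := (starKer φ).star_mem'
  isClosed' := isClosed_starKer φ

theorem mem_ker {B : Type*} [NonUnitalCStarAlgebra B] {φ : A →⋆ₙₐ[ℂ] B} {a : A} :
    a ∈ ker φ ↔ φ a = 0 :=
  mem_starKer

theorem mem_bot {a : A} : a ∈ (⊥ : ClosedIdeal A) ↔ a = 0 := Iff.rfl

namespace Quot

/-- The quotient map `A → A / I`, as a *-homomorphism. -/
def mkHom : A →⋆ₙₐ[ℂ] I.Quot where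
  toFun := mk I
  map_smul' := mk_smul I
  map_zero' := mk_zero I
  map_add' := mk_add I
  map_mul' := mk_mul I
  map_star' := mk_star I

theorem isOpenQuotientMap_mk : IsOpenQuotientMap (mk I) :=
  I.toSubmodule.isOpenQuotientMap_mkQ

instance : IsTopologicalAddGroup I.Quot :=
  inferInstanceAs (IsTopologicalAddGroup (A ⧸ I.toSubmodule))

instance : ContinuousConstSMul ℂ I.Quot :=
  inferInstanceAs (ContinuousConstSMul ℂ (A ⧸ I.toSubmodule))

instance : IsTopologicalSemiring I.Quot where
  continuous_mul := by
    rw [← ((isOpenQuotientMap_mk I).prodMap (isOpenQuotientMap_mk I)).continuous_comp_iff]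
    exact (isOpenQuotientMap_mk I).continuous.comp continuous_mul

instance : ContinuousStar I.Quot where
  continuous_star := by
    rw [← (isOpenQuotientMap_mk I).continuous_comp_iff]
    exact (isOpenQuotientMap_mk I).continuous.comp continuous_star

variable {I J}

theorem mk_eq_zero_iff {a : A} : mk I a = 0 ↔ a ∈ I := by
  rw [← mk_zero, mk_eq_mk_iff, sub_zero]

theorem mk_mem_image_iff (hIJ : I ≤ J) {a : A} : mk I a ∈ mk I '' (J : Set A) ↔ a ∈ J := by
  refine ⟨fun ⟨b, hb, hab⟩ => ?_, Set.mem_image_of_mem _⟩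
  have h := J.toSubmodule.sub_mem hb (hIJ ((mk_eq_mk_iff I b a).1 hab))
  rwa [sub_sub_cancel] at h

theorem isClosed_image_mk (hIJ : I ≤ J) : IsClosed (mk I '' (J : Set A)) := by
  rw [← (isOpenQuotientMap_mk I).isQuotientMap.isClosed_preimage]
  have hpre : mk I ⁻¹' (mk I '' (J : Set A)) = J := Set.ext fun _ => mk_mem_image_iff hIJ
  rw [hpre]
  exact J.isClosed'

end Quot

variable {I J}

theorem isMinimalProjection_mk {p : A} (h0 : p ∉ I) (hp : IsStarProjection p)
    (h : ∀ a, ∃ c : ℂ, p * a * p - c • p ∈ I) : IsMinimalProjection (Quot.mk I p) := by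
  refine isMinimalProjection_iff.2
    ⟨mt Quot.mk_eq_zero_iff.1 h0, hp.map (Quot.mkHom I),
      (Quot.mk_surjective I).forall.2 fun a => ?_⟩
  obtain ⟨c, hc⟩ := h a
  exact ⟨c, (Quot.mk_eq_mk_iff I _ _).2 hc⟩

theorem exists_mul_mul_sub_smul_mem {p : A} (hp : IsMinimalProjection (Quot.mk I p)) (a : A) :
    ∃ c : ℂ, p * a * p - c • p ∈ I := by
  obtain ⟨c, hc⟩ := hp.exists_mul_mul_eq_smul (Quot.mk I a)
  exact ⟨c, (Quot.mk_eq_mk_iff I _ _).1 hc⟩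

theorem atomIdeal_quot_eq (hIJ : I ≤ J)
    (hmem : ∀ p, IsMinimalProjection (Quot.mk I p) → p ∈ J)
    (hgen : ∀ S : NonUnitalStarSubalgebra ℂ A, IsClosed (S : Set A) → (I : Set A) ⊆ S →
      (∀ p, IsMinimalProjection (Quot.mk I p) → p ∈ S) → (J : Set A) ⊆ S) :
    atomIdeal I.Quot = Quot.mk I '' (J : Set A) := by
  refine (atomIdeal_subset (S := J.toStarSubalgebra.map (Quot.mkHom I))
    (Quot.isClosed_image_mk hIJ) ((Quot.mk_surjective I).forall.2 fun p hp =>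
      ⟨p, hmem p hp, rfl⟩)).antisymm (Set.image_subset_iff.2 ?_)
  refine hgen ((NonUnitalStarAlgebra.adjoin ℂ {p : I.Quot |
    IsMinimalProjection p}).topologicalClosure.comap (Quot.mkHom I))
    (isClosed_closure.preimage (Quot.isOpenQuotientMap_mk I).continuous) (fun a ha => ?_)
    fun p hp => hp.mem_atomIdeal
  rw [SetLike.mem_coe, NonUnitalStarSubalgebra.mem_comap,
    show Quot.mkHom I a = 0 from Quot.mk_eq_zero_iff.2 ha]
  exact zero_mem _

end ClosedIdeal

end Quotients

section Derivatives

variable {X Y : Type*} [TopologicalSpace X] [CStarAlgebra Y]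

theorem ext_of_forall_coe [NoncompactSpace X] {f g : C(OnePoint X, Y)}
    (h : ∀ x : X, f x = g x) : f = g :=
  DFunLike.coe_injective (denseRange_coe.equalizer f.continuous g.continuous (funext h))

variable (X Y) in
/-- The inclusion of the constant functions, as a *-homomorphism. -/
def constHom : Y →⋆ₐ[ℂ] C(X, Y) where
  toFun b := ContinuousMap.const X b
  map_one' := rfl
  map_mul' _ _ := rfl
  map_zero' := rfl
  map_add' _ _ := rfl
  commutes' _ := rfl
  map_star' _ := rfl

variable (X) in
/-- The ideal of all functions with values in `ker σ` on `X` which vanish at `∞`. -/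
def vanishingIdeal (σ : Y →⋆ₐ[ℂ] ℂ) :
    ClosedIdeal C(OnePoint X, Y) :=
  .ker (B := C(OnePoint X, ℂ) × Y) (NonUnitalStarAlgHom.prod
    (ContinuousMap.compStarAlgHom (OnePoint X) σ (map_continuous σ)) (evalHom ∞))

variable (X) in
/-- The ideal of all functions with value at `∞` in `ker σ`. -/
def limitIdeal (σ : Y →⋆ₐ[ℂ] ℂ) :
    ClosedIdeal C(OnePoint X, Y) :=
  .ker (NonUnitalStarAlgHom.comp (σ : Y →⋆ₙₐ[ℂ] ℂ) (evalHom ∞))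

variable {σ : Y →⋆ₐ[ℂ] ℂ}

theorem mem_limitIdeal {f : C(OnePoint X, Y)} : f ∈ limitIdeal X σ ↔ σ (f ∞) = 0 :=
  ClosedIdeal.mem_ker

theorem mem_vanishingIdeal {f : C(OnePoint X, Y)} :
    f ∈ vanishingIdeal X σ ↔ (∀ x : X, σ (f x) = 0) ∧ f ∞ = 0 := by
  rw [vanishingIdeal, ClosedIdeal.mem_ker]
  refine Prod.mk_eq_zero.trans (and_congr_left fun h' =>
    ⟨fun h x => DFunLike.congr_fun h (x : OnePoint X), fun h => ContinuousMap.ext fun z => ?_⟩)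
  induction z using OnePoint.rec with
  | infty => exact (congrArg σ h').trans (map_zero σ)
  | coe x => exact h x

theorem vanishingIdeal_le_limitIdeal : vanishingIdeal X σ ≤ limitIdeal X σ := fun f hf =>
  mem_limitIdeal.2 (by rw [(mem_vanishingIdeal.1 hf).2, map_zero])

namespace ClosedIdeal

theorem isMinimalProjection_mk_vanishingIdeal_const {q : Y} (hq : IsMinimalProjection q)
    (hσ : σ q = 0) : IsMinimalProjection (Quot.mk (vanishingIdeal X σ) (constHom _ Y q)) := by
  refine isMinimalProjection_mk (fun h => hq.1 (mem_vanishingIdeal.1 h).2)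
    (hq.2.1.map (constHom _ Y)) fun f => ?_
  obtain ⟨c, hc⟩ := hq.exists_mul_mul_eq_smul (f ∞)
  refine ⟨c, mem_vanishingIdeal.2 ⟨fun x => ?_, sub_eq_zero.2 hc⟩⟩
  change σ (q * f x * q - c • q) = 0
  rw [map_sub, map_mul, map_smul, hσ, mul_zero, smul_zero, sub_zero]

variable (X σ) in
theorem isMinimalProjection_mk_limitIdeal_one :
    IsMinimalProjection (Quot.mk (limitIdeal X σ) 1) := by
  refine isMinimalProjection_mk
    (fun h => one_ne_zero ((map_one σ).symm.trans (mem_limitIdeal.1 h))) (.one _)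
    fun f => ⟨σ (f ∞), mem_limitIdeal.2 ?_⟩
  change σ (1 * f ∞ * 1 - σ (f ∞) • 1) = 0
  rw [one_mul, mul_one, map_sub, map_smul, map_one, smul_eq_mul, mul_one, sub_self]

variable (X σ) in
theorem atomIdeal_quot_limitIdeal :
    atomIdeal (limitIdeal X σ).Quot =
      Quot.mk (limitIdeal X σ) ''
        ((⊤ : ClosedIdeal C(OnePoint X, Y)) : Set C(OnePoint X, Y)) := by
  refine atomIdeal_quot_eq (fun _ _ => trivial) (fun _ _ => trivial) fun S _ hI hmin f _ => ?_
  rw [← add_sub_cancel (σ (f ∞) • 1) f]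
  refine add_mem (S.smul_mem _ (hmin _ (isMinimalProjection_mk_limitIdeal_one X σ)))
    (hI (mem_limitIdeal.2 ?_))
  change σ (f ∞ - σ (f ∞) • 1) = 0
  rw [map_sub, map_smul, map_one, smul_eq_mul, mul_one, sub_self]

end ClosedIdeal

variable [DiscreteTopology X]

theorem pointMass_injective (x : X) : Function.Injective (pointMass x : Y → C(OnePoint X, Y)) :=
  fun b c h => by simpa only [pointMass_apply_self] using DFunLike.congr_fun h (x : OnePoint X)

theorem pointMass_mem_vanishingIdeal_iff {x : X} {b : Y} :
    pointMass x b ∈ vanishingIdeal X σ ↔ σ b = 0 := by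
  rw [mem_vanishingIdeal]
  refine ⟨fun h => by simpa only [pointMass_apply_self] using h.1 x,
    fun h => ⟨fun y => ?_, pointMass_apply_infty x b⟩⟩
  rcases eq_or_ne y x with rfl | hne
  · rwa [pointMass_apply_self]
  · rw [pointMass_apply_of_ne (coe_injective.ne hne), map_zero]

theorem IsMinimalProjection.exists_eq_pointMass [NoncompactSpace X] {p : C(OnePoint X, Y)}
    (hp : IsMinimalProjection p) :
    ∃ (x : X) (q : Y), IsMinimalProjection q ∧ p = pointMass x q := by
  obtain ⟨x, hx⟩ : ∃ x : X, p x ≠ 0 := by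
    by_contra! h
    exact hp.1 (ext_of_forall_coe h)
  obtain ⟨c, hc⟩ := hp.exists_mul_mul_eq_smul (pointMass x 1)
  have hpx : p x * p x = p x := DFunLike.congr_fun hp.mul_self (x : OnePoint X)
  rw [mul_pointMass, pointMass_mul, mul_one, hpx] at hc
  have hc0 : c ≠ 0 := by
    rintro rfl
    rw [zero_smul] at hc
    exact hx (pointMass_injective x (hc.trans (map_zero (pointMass x)).symm))
  have heq : p = pointMass x (c⁻¹ • p x) := by rw [map_smul, hc, inv_smul_smul₀ hc0]
  exact ⟨x, _, .of_map (pointMass x) (pointMass_injective x) (heq ▸ hp), heq⟩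

namespace ClosedIdeal

theorem isMinimalProjection_mk_bot_pointMass (x : X) {q : Y} (hq : IsMinimalProjection q) :
    IsMinimalProjection (Quot.mk (⊥ : ClosedIdeal C(OnePoint X, Y)) (pointMass x q)) := by
  refine isMinimalProjection_mk (fun h => hq.1 (pointMass_injective x ?_))
    (hq.2.1.map (pointMass x)) fun f => ?_
  · exact (mem_bot.1 h).trans (map_zero (pointMass x)).symm
  · obtain ⟨c, hc⟩ := hq.exists_mul_mul_eq_smul (f x)
    refine ⟨c, mem_bot.2 (sub_eq_zero.2 ?_)⟩
    rw [pointMass_mul, mul_pointMass, pointMass_apply_self, hc, map_smul]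

variable (σ) in
theorem isMinimalProjection_mk_vanishingIdeal_pointMass (x : X) :
    IsMinimalProjection (Quot.mk (vanishingIdeal X σ) (pointMass x 1)) := by
  refine isMinimalProjection_mk (fun h => ?_) ((IsStarProjection.one Y).map (pointMass x))
    fun f => ⟨σ (f x), ?_⟩
  · exact one_ne_zero ((map_one σ).symm.trans (pointMass_mem_vanishingIdeal_iff.1 h))
  · rw [pointMass_mul, mul_pointMass, pointMass_apply_self, one_mul, mul_one, ← map_smul,
      ← map_sub, pointMass_mem_vanishingIdeal_iff, map_sub, map_smul, map_one, smul_eq_mul,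
      mul_one, sub_self]

theorem atomIdeal_quot_bot [NoncompactSpace X] (hσ : atomIdeal Y = {b | σ b = 0}) :
    atomIdeal (⊥ : ClosedIdeal C(OnePoint X, Y)).Quot =
      Quot.mk ⊥ '' (vanishingIdeal X σ : Set C(OnePoint X, Y)) := by
  refine atomIdeal_quot_eq (fun f hf => ?_) (fun p hp => ?_) fun S hS _ hmin f hf => ?_
  · rw [mem_bot.1 hf]
    exact zero_mem (vanishingIdeal X σ).toSubmodule
  · obtain ⟨x, q, hq, rfl⟩ := (hp.of_map (Quot.mkHom ⊥) fun f g h =>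
      sub_eq_zero.1 ((Quot.mk_eq_mk_iff _ f g).1 h)).exists_eq_pointMass
    exact pointMass_mem_vanishingIdeal_iff.2 (hσ.subset hq.mem_atomIdeal)
  · obtain ⟨hf, hf'⟩ := mem_vanishingIdeal.1 hf
    refine mem_of_const_mem_of_pointMass_mem hS ?_ fun x => ?_
    · rw [hf']
      exact zero_mem S
    · rw [hf', sub_zero]
      exact atomIdeal_subset (S := S.comap (pointMass x))
        (hS.preimage (map_continuous (pointMass x)))
        (fun q hq => hmin _ (isMinimalProjection_mk_bot_pointMass x hq)) (hσ.superset (hf x))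

theorem atomIdeal_quot_vanishingIdeal [NoncompactSpace X] (hσ : atomIdeal Y = {b | σ b = 0}) :
    atomIdeal (vanishingIdeal X σ).Quot =
      Quot.mk (vanishingIdeal X σ) '' (limitIdeal X σ : Set C(OnePoint X, Y)) := by
  refine atomIdeal_quot_eq vanishingIdeal_le_limitIdeal (fun p hp => ?_)
    fun S hS hI hmin f hf => ?_
  · rw [mem_limitIdeal]
    by_contra hp'
    have hp0 : p ∞ ≠ 0 := fun h => hp' (by rw [h, map_zero])
    have hσp (x : X) : σ (p x) = 0 := by
      obtain ⟨c, hc⟩ := exists_mul_mul_sub_smul_mem hp (pointMass x 1)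
      obtain ⟨hc, hc'⟩ := mem_vanishingIdeal.1 hc
      have hc0 : c = 0 := by
        change p ∞ * pointMass x 1 ∞ * p ∞ - c • p ∞ = 0 at hc'
        rw [pointMass_apply_infty, mul_zero, zero_mul, zero_sub, neg_eq_zero] at hc'
        exact (smul_eq_zero.1 hc').resolve_right hp0
      have hx : σ (p x * pointMass x 1 x * p x - c • p x) = 0 := hc x
      rw [pointMass_apply_self, hc0, zero_smul, sub_zero, mul_one, map_mul] at hx
      exact mul_self_eq_zero.1 hx
    exact hp' (DFunLike.congr_fun (ext_of_forall_coe (Y := ℂ)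
      (f := ContinuousMap.compStarAlgHom (OnePoint X) σ (map_continuous σ) p) (g := 0) hσp) ∞)
  · refine mem_of_const_mem_of_pointMass_mem hS ?_ fun x => ?_
    · exact atomIdeal_subset (S := S.comap (constHom (OnePoint X) Y))
        (hS.preimage (map_continuous (constHom (OnePoint X) Y)))
        (fun q hq => hmin _ (isMinimalProjection_mk_vanishingIdeal_const hq
          (hσ.subset hq.mem_atomIdeal))) (hσ.superset (mem_limitIdeal.1 hf))
    · set b := f x - f ∞
      have hb : pointMass x b = σ b • pointMass x 1 + pointMass x (b - σ b • 1) := by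
        rw [← map_smul, ← map_add, add_sub_cancel]
      rw [hb]
      refine add_mem (S.smul_mem _ (hmin _ (isMinimalProjection_mk_vanishingIdeal_pointMass σ x)))
        (hI (pointMass_mem_vanishingIdeal_iff.2 ?_))
      rw [map_sub, map_smul, map_one, smul_eq_mul, mul_one, sub_self]

end ClosedIdeal

end Derivatives

section CantorBendixson

variable {A : Type u} [NonUnitalCStarAlgebra A]

namespace IsCantorBendixsonSequence

variable {θ θ' : Ordinal.{u}} {I I' : Ordinal.{u} → ClosedIdeal A}

theorem mem_succ_iff (h : IsCantorBendixsonSequence A θ I) {α : Ordinal.{u}} (hα : α < θ)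
    {a : A} :
    a ∈ I (Order.succ α) ↔ ClosedIdeal.Quot.mk (I α) a ∈ atomIdeal (I α).Quot := by
  rw [h.derivative α hα, ClosedIdeal.Quot.mk_mem_image_iff]
  exact (h.strictMono α _ (Order.lt_succ α) (Order.succ_le_of_lt hα)).le

theorem eq_of_le (h : IsCantorBendixsonSequence A θ I) (h' : IsCantorBendixsonSequence A θ' I')
    {α : Ordinal.{u}} (hα : α ≤ θ) (hα' : α ≤ θ') : I α = I' α := by
  induction α using Ordinal.limitRecOn with
  | zero => rw [h.zero, h'.zero]
  | add_one β ih =>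
    rw [← Order.succ_eq_add_one] at hα hα' ⊢
    have hβ := Order.lt_succ β
    have hI := ih (hβ.le.trans hα) (hβ.le.trans hα')
    refine SetLike.ext fun a => ?_
    rw [h.mem_succ_iff (hβ.trans_le hα), h'.mem_succ_iff (hβ.trans_le hα'), hI]
  | limit β hlim ih =>
    refine SetLike.coe_injective ?_
    rw [h.continuous β hα hlim, h'.continuous β hα' hlim]
    exact congrArg closure (Set.iUnion₂_congr fun γ hγ =>
      congrArg _ (ih γ hγ (hγ.le.trans hα) (hγ.le.trans hα')))

theorem height_le (h : IsCantorBendixsonSequence A θ I)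
    (h' : IsCantorBendixsonSequence A θ' I') : θ ≤ θ' := by
  by_contra! hlt
  have htop : I θ' = I θ := by rw [h.eq_of_le h' hlt.le le_rfl, h'.top, h.top]
  exact (h.strictMono _ _ hlt le_rfl).ne htop

theorem height_eq (h : IsCantorBendixsonSequence A θ I)
    (h' : IsCantorBendixsonSequence A θ' I') : θ = θ' :=
  (h.height_le h').antisymm (h'.height_le h)

theorem of_nat {J : ℕ → ClosedIdeal A} {n : ℕ} (h0 : J 0 = ⊥) (htop : J n = ⊤)
    (hlt : ∀ m < n, J m < J (m + 1))
    (hder : ∀ m < n, atomIdeal (J m).Quot =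
      ClosedIdeal.Quot.mk (J m) '' (J (m + 1) : Set A)) :
    IsCantorBendixsonSequence A n fun α => J (Cardinal.toNat α.card) := by
  have hJ (m : ℕ) : J (Cardinal.toNat (m : Ordinal.{u}).card) = J m := by
    rw [Ordinal.card_nat, Cardinal.toNat_natCast]
  have exists_nat : ∀ α ≤ (n : Ordinal.{u}), ∃ m : ℕ, α = m := fun α hα =>
    Ordinal.lt_omega0.1 (hα.trans_lt (Ordinal.natCast_lt_omega0 n))
  refine ⟨?_, ?_, fun α β hαβ hβ => ?_, fun α hα hlim => ?_, fun α hα => ?_⟩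
  · rw [← h0, ← hJ 0, Nat.cast_zero]
  · rw [← htop, ← hJ n]
  · obtain ⟨a, rfl⟩ := exists_nat α (hαβ.le.trans hβ)
    obtain ⟨b, rfl⟩ := exists_nat β hβ
    rw [hJ, hJ]
    rw [Nat.cast_lt] at hαβ
    rw [Nat.cast_le] at hβ
    exact strictMonoOn_Iic_of_lt_succ hlt (hαβ.le.trans hβ) hβ hαβ
  · obtain ⟨a, rfl⟩ := exists_nat α hα
    exact absurd (Ordinal.omega0_le_of_isSuccLimit hlim) (Ordinal.natCast_lt_omega0 a).not_ge
  · obtain ⟨a, rfl⟩ := exists_nat α hα.le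
    rw [Order.succ_eq_add_one, ← Nat.cast_succ, hJ, hJ]
    exact hder a (Nat.cast_lt.1 hα)

end IsCantorBendixsonSequence

section Function

variable {X Y : Type*} [TopologicalSpace X] [CStarAlgebra Y]

variable (X) in
/-- The Cantor–Bendixson sequence of `C(OnePoint X, Y)`, for `σ` with kernel `I^At(Y)`. -/
def derivedIdeal (σ : Y →⋆ₐ[ℂ] ℂ) : ℕ → ClosedIdeal C(OnePoint X, Y)
  | 0 => ⊥
  | 1 => vanishingIdeal X σ
  | 2 => limitIdeal X σ
  | _ => ⊤

theorem derivedIdeal_lt_succ [DiscreteTopology X] [Nonempty X] {σ : Y →⋆ₐ[ℂ] ℂ} {q : Y}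
    (hq : q ≠ 0) (hσq : σ q = 0) :
    ∀ m < 3, derivedIdeal X σ m < derivedIdeal X σ (m + 1) := by
  obtain ⟨x⟩ := ‹Nonempty X›
  have hone : σ 1 ≠ 0 := by simp only [map_one, ne_eq, one_ne_zero, not_false_eq_true]
  intro m hm
  interval_cases m
  · refine SetLike.lt_iff_le_and_exists.2 ⟨fun f hf => ?_, pointMass x q,
      pointMass_mem_vanishingIdeal_iff.2 hσq, fun h => hq (pointMass_injective x ?_)⟩
    · rw [ClosedIdeal.mem_bot.1 hf]
      exact zero_mem (vanishingIdeal X σ).toSubmodule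
    · exact (ClosedIdeal.mem_bot.1 h).trans (map_zero (pointMass x)).symm
  · refine SetLike.lt_iff_le_and_exists.2 ⟨vanishingIdeal_le_limitIdeal, pointMass x 1,
      mem_limitIdeal.2 ?_, fun h => hone (pointMass_mem_vanishingIdeal_iff.1 h)⟩
    rw [pointMass_apply_infty, map_zero]
  · exact SetLike.lt_iff_le_and_exists.2 ⟨fun _ _ => trivial, 1, trivial,
      fun h => hone (mem_limitIdeal.1 h)⟩

end Function

theorem isCantorBendixsonSequence_derivedIdeal {X Y : Type u} [TopologicalSpace X]
    [DiscreteTopology X] [NoncompactSpace X] [CStarAlgebra Y] {σ : Y →⋆ₐ[ℂ] ℂ}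
    (hσ : atomIdeal Y = {b | σ b = 0}) {q : Y} (hq : IsMinimalProjection q) :
    IsCantorBendixsonSequence C(OnePoint X, Y) 3
      fun α => derivedIdeal X σ (Cardinal.toNat α.card) := by
  have : Nonempty X := not_isEmpty_iff.1 fun _ => not_compactSpace_iff.2 ‹_› inferInstance
  have hσq : σ q = 0 := hσ.subset hq.mem_atomIdeal
  rw [← Nat.cast_ofNat (R := Ordinal.{u})]
  refine .of_nat rfl rfl (derivedIdeal_lt_succ hq.1 hσq) fun m hm => ?_
  interval_cases m
  · exact ClosedIdeal.atomIdeal_quot_bot hσ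
  · exact ClosedIdeal.atomIdeal_quot_vanishingIdeal hσ
  · exact ClosedIdeal.atomIdeal_quot_limitIdeal X σ

end CantorBendixson

section CCR

namespace IsIrreducibleRep

variable {A B : Type*} [NonUnitalCStarAlgebra A] [NonUnitalCStarAlgebra B] {H : Type*}
  [NormedAddCommGroup H] [InnerProductSpace ℂ H] [CompleteSpace H]

theorem of_comp {φ : A →⋆ₙₐ[ℂ] B} {ρ : B →⋆ₙₐ[ℂ] (H →L[ℂ] H)}
    (h : IsIrreducibleRep (ρ.comp φ)) : IsIrreducibleRep ρ :=
  ⟨fun h0 => h.1 (by rw [h0]; rfl), fun S hS hinv => h.2 S hS fun a => hinv (φ a)⟩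

theorem comp {ρ : B →⋆ₙₐ[ℂ] (H →L[ℂ] H)} (h : IsIrreducibleRep ρ) {φ : A →⋆ₙₐ[ℂ] B}
    (hφ : Function.Surjective φ) : IsIrreducibleRep (ρ.comp φ) :=
  ⟨fun h0 => h.1 (DFunLike.ext _ _ (hφ.forall.2 fun a => DFunLike.congr_fun h0 a)),
    fun S hS hinv => h.2 S hS (hφ.forall.2 hinv)⟩

variable {π : A →⋆ₙₐ[ℂ] (H →L[ℂ] H)}

theorem denseRange_apply (hπ : IsIrreducibleRep π) {a : A} {x : H} (hx : π a x ≠ 0) :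
    DenseRange fun b => π b x := by
  let orbit : A →ₗ[ℂ] H :=
    { toFun := fun b => π b x
      map_add' := fun b c => by rw [map_add]; rfl
      map_smul' := fun c b => by rw [map_smul]; rfl }
  have hmaps (b : A) : Set.MapsTo (π b) (LinearMap.range orbit : Set H)
      (LinearMap.range orbit) := by
    rintro _ ⟨c, rfl⟩
    exact ⟨b * c, congrArg (fun T : H →L[ℂ] H => T x) (map_mul π b c)⟩
  have htop := (hπ.2 _ (LinearMap.range orbit).isClosed_topologicalClosure
    fun b y hy => (hmaps b).closure (π b).continuous hy).resolve_left fun hbot =>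
      hx ((Submodule.eq_bot_iff _).1 hbot _ (subset_closure ⟨a, rfl⟩))
  exact fun y => (Submodule.eq_top_iff'.1 htop) y

theorem map_eq_zero_or_eq_one (hπ : IsIrreducibleRep π) {e : A} (hee : e * e = e)
    (hcomm : ∀ a, Commute e a) : π e = 0 ∨ π e = 1 := by
  have hidem (x : H) : π e (π e x) = π e x :=
    congrArg (fun T : H →L[ℂ] H => T x) ((map_mul π e e).symm.trans (congrArg π hee))
  have hinv (a : A) (x : H) (hx : x ∈ (π e).ker) : π a x ∈ (π e).ker := by
    have hcomm' : π e (π a x) = π a (π e x) :=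
      congrArg (fun T : H →L[ℂ] H => T x) ((hcomm a).map π).eq
    exact hcomm'.trans ((congrArg (π a) hx).trans (map_zero (π a)))
  rcases hπ.2 _ (π e).isClosed_ker hinv with h | h
  · refine .inr (ContinuousLinearMap.ext fun x => sub_eq_zero.1 ((Submodule.eq_bot_iff _).1 h _ ?_))
    exact (map_sub (π e) _ _).trans (sub_eq_zero.2 (hidem x))
  · exact .inl (ContinuousLinearMap.ext fun x => Submodule.eq_top_iff'.1 h x)

theorem exists_eq_comp_evalHom {X Y : Type*} [TopologicalSpace X] [DiscreteTopology X]
    [CStarAlgebra Y] {π : C(OnePoint X, Y) →⋆ₙₐ[ℂ] (H →L[ℂ] H)} (hπ : IsIrreducibleRep π) :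
    ∃ (z : OnePoint X) (ρ : Y →⋆ₙₐ[ℂ] (H →L[ℂ] H)), π = ρ.comp (evalHom z) := by
  have hmass (x : X) : π (pointMass x 1) = 0 ∨ π (pointMass x 1) = 1 :=
    hπ.map_eq_zero_or_eq_one (by rw [← map_mul, mul_one])
      fun f => by rw [commute_iff_eq, pointMass_mul, mul_pointMass, one_mul, mul_one]
  have hmul (x : X) (b : Y) : π (pointMass x b) = π (pointMass x 1) * π (pointMass x b) := by
    rw [← map_mul, ← map_mul, one_mul]
  by_cases h : ∃ x, π (pointMass x 1) = 1
  · obtain ⟨x, hx⟩ := h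
    refine ⟨x, π.comp (pointMass x), NonUnitalStarAlgHom.ext fun f => ?_⟩
    change π f = π (pointMass x (f x))
    rw [← one_mul (f x), ← pointMass_mul, map_mul, hx, one_mul]
  · push Not at h
    refine ⟨∞, π.comp (constHom (OnePoint X) Y : Y →⋆ₙₐ[ℂ] C(OnePoint X, Y)),
      NonUnitalStarAlgHom.ext fun f => ?_⟩
    let g : C(OnePoint X, Y) := f - constHom _ Y (f ∞)
    suffices hg : g ∈ starKer π from sub_eq_zero.1 ((map_sub π _ _).symm.trans (mem_starKer.1 hg))
    refine mem_of_const_mem_of_pointMass_mem (isClosed_starKer π) ?_ fun x => ?_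
    · rw [show g ∞ = 0 from sub_self (f ∞)]
      exact zero_mem (starKer π)
    · rw [mem_starKer, hmul, (hmass x).resolve_right (h x), zero_mul]

end IsIrreducibleRep

theorem isCompactOperator_of_forall_mem_span {H : Type*} [NormedAddCommGroup H]
    [InnerProductSpace ℂ H] {T : H →L[ℂ] H} {y : H} (h : ∀ x, T x ∈ Submodule.span ℂ {y}) :
    IsCompactOperator T :=
  (isCompactOperator_of_locallyCompactSpace_dom (T.codRestrict _ h)).clm_comp
    (Submodule.span ℂ {y}).subtypeL

theorem IsMinimalProjection.mem_ccrIdeal {A : Type u} [NonUnitalCStarAlgebra A] {p : A}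
    (hp : IsMinimalProjection p) : p ∈ ccrIdeal A := by
  intro H _ _ _ π hπ
  by_cases h0 : ∃ x, π p x ≠ 0
  · obtain ⟨x, hx⟩ := h0
    refine isCompactOperator_of_forall_mem_span (y := π p x) fun y => ?_
    have hy : y ∈ closure (Set.range fun a => π a (π p x)) := by
      refine hπ.denseRange_apply (a := p) ?_ y
      rwa [← mul_apply_eq_comp, ← map_mul, hp.mul_self]
    refine closure_minimal ?_ ((Submodule.closed_of_finiteDimensional
      (Submodule.span ℂ {π p x})).preimage (π p).continuous) hy
    rintro _ ⟨a, rfl⟩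
    obtain ⟨c, hc⟩ := hp.exists_mul_mul_eq_smul a
    refine Submodule.mem_span_singleton.2 ⟨c, ?_⟩
    change (c • π p) x = (π p * π a * π p) x
    rw [← map_smul, ← hc, map_mul, map_mul]
  · push Not at h0
    rw [show π p = 0 from ContinuousLinearMap.ext h0]
    exact isCompactOperator_zero

variable {X Y : Type u} [TopologicalSpace X] [DiscreteTopology X] [CStarAlgebra Y]

theorem mem_ccrIdeal_continuousMap_onePoint_iff {f : C(OnePoint X, Y)} :
    f ∈ ccrIdeal C(OnePoint X, Y) ↔ ∀ z, f z ∈ ccrIdeal Y := by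
  refine ⟨fun hf z H _ _ _ ρ hρ => hf H (ρ.comp (evalHom z)) (hρ.comp fun b =>
    ⟨ContinuousMap.const _ b, rfl⟩), fun hf H _ _ _ π hπ => ?_⟩
  obtain ⟨z, ρ, rfl⟩ := hπ.exists_eq_comp_evalHom
  exact hf z H ρ hπ.of_comp

theorem derivedIdeal_ne_ccrIdeal [Nonempty X] (σ : Y →⋆ₐ[ℂ] ℂ) {q : Y}
    (hq : IsMinimalProjection q) (h1 : 1 ∉ ccrIdeal Y) (n : ℕ) :
    derivedIdeal X σ n ≠ ccrIdeal C(OnePoint X, Y) := by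
  obtain ⟨x⟩ := ‹Nonempty X›
  have hconst : constHom _ Y q ∈ ccrIdeal C(OnePoint X, Y) :=
    mem_ccrIdeal_continuousMap_onePoint_iff.2 fun _ => hq.mem_ccrIdeal
  have hmass : pointMass x 1 ∉ ccrIdeal C(OnePoint X, Y) := fun h =>
    h1 (pointMass_apply_self x (1 : Y) ▸ mem_ccrIdeal_continuousMap_onePoint_iff.1 h x)
  intro h
  rw [← h] at hconst hmass
  match n with
  | 0 => exact hq.1 (DFunLike.congr_fun (ClosedIdeal.mem_bot.1 hconst) ∞)
  | 1 => exact hq.1 (mem_vanishingIdeal.1 hconst).2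
  | 2 => exact hmass (mem_limitIdeal.2 (by rw [pointMass_apply_infty, map_zero]))
  | _ + 3 => exact hmass trivial

theorem IsCantorBendixsonSequence.height_eq_three_and_forall_ne_ccrIdeal [NoncompactSpace X]
    {θ : Ordinal.{u}} {I : Ordinal.{u} → ClosedIdeal C(OnePoint X, Y)}
    (hI : IsCantorBendixsonSequence C(OnePoint X, Y) θ I) {σ : Y →⋆ₐ[ℂ] ℂ}
    (hσ : atomIdeal Y = {b | σ b = 0}) {q : Y} (hq : IsMinimalProjection q)
    (h1 : 1 ∉ ccrIdeal Y) : θ = 3 ∧ ∀ α ≤ θ, I α ≠ ccrIdeal C(OnePoint X, Y) := by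
  have : Nonempty X := not_isEmpty_iff.1 fun _ => not_compactSpace_iff.2 ‹_› inferInstance
  have hseq := isCantorBendixsonSequence_derivedIdeal (X := X) hσ hq
  obtain rfl := hI.height_eq hseq
  refine ⟨rfl, fun α hα => ?_⟩
  rw [hI.eq_of_le hseq hα hα]
  exact derivedIdeal_ne_ccrIdeal σ hq h1 _

end CCR

section TensorProduct

open scoped TensorProduct

theorem exists_starAlgHom_of_denseRange {E F G : Type*} [Semiring E] [StarRing E] [Algebra ℂ E]
    [CStarAlgebra F] [CStarAlgebra G] {e : E →⋆ₐ[ℂ] F} (he : DenseRange e) {f : E →⋆ₐ[ℂ] G}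
    (hf : ∀ x, ‖f x‖ ≤ ‖e x‖) : ∃ g : F →⋆ₐ[ℂ] G, ∀ x, g (e x) = f x := by
  let : AddCommGroup E := Module.addCommMonoidToAddCommGroup ℂ
  let g : F →L[ℂ] G := (f.toAlgHom.toLinearMap).extendOfNorm e.toAlgHom.toLinearMap
  have hg (x : E) : g (e x) = f x :=
    LinearMap.extendOfNorm_eq (f := f.toAlgHom.toLinearMap) (e := e.toAlgHom.toLinearMap) he
      ⟨1, fun x => (hf x).trans_eq (one_mul _).symm⟩ x
  have hmul (a b : F) : g (a * b) = g a * g b := by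
    refine he.induction_on₂ (isClosed_eq (by fun_prop) (by fun_prop)) (fun x y => ?_) a b
    rw [← map_mul, hg, hg, hg, map_mul]
  have hone : g 1 = 1 := by rw [← map_one e, hg, map_one]
  refine ⟨⟨AlgHom.ofLinearMap g.toLinearMap hone hmul, fun a => ?_⟩, hg⟩
  refine he.induction_on a (isClosed_eq (g.continuous.comp continuous_star)
    (continuous_star.comp g.continuous)) fun x => ?_
  exact (congrArg g (map_star e x).symm).trans
    ((hg (star x)).trans ((map_star f x).trans (congrArg star (hg x).symm)))

/-- The *-homomorphism `a ⊗ b ↦ i a * j b` for `i` and `j` with commuting images. -/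
def starTensorLift {A B T : Type*} [CStarAlgebra A] [CStarAlgebra B] [CStarAlgebra T]
    (i : A →⋆ₐ[ℂ] T) (j : B →⋆ₐ[ℂ] T) (h : ∀ a b, Commute (i a) (j b)) : A ⊗[ℂ] B →⋆ₐ[ℂ] T where
  toAlgHom := Algebra.TensorProduct.lift (i : A →ₐ[ℂ] T) (j : B →ₐ[ℂ] T) h
  map_star' t := by
    change Algebra.TensorProduct.lift (i : A →ₐ[ℂ] T) (j : B →ₐ[ℂ] T) h (star t) =
      star (Algebra.TensorProduct.lift (i : A →ₐ[ℂ] T) (j : B →ₐ[ℂ] T) h t)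
    induction t with
    | zero => simp only [star_zero, map_zero]
    | tmul a b =>
      rw [TensorProduct.star_tmul, Algebra.TensorProduct.lift_tmul,
        Algebra.TensorProduct.lift_tmul, star_mul]
      exact (congrArg₂ (· * ·) (map_star i a) (map_star j b)).trans ((h a b).star_star).eq
    | add s t hs ht => rw [star_add, map_add, map_add, star_add, hs, ht]

theorem starTensorLift_tmul {A B T : Type*} [CStarAlgebra A] [CStarAlgebra B] [CStarAlgebra T]
    {i : A →⋆ₐ[ℂ] T} {j : B →⋆ₐ[ℂ] T} (h : ∀ a b, Commute (i a) (j b)) (a : A) (b : B) :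
    starTensorLift i j h (a ⊗ₜ b) = i a * j b :=
  Algebra.TensorProduct.lift_tmul (i : A →ₐ[ℂ] T) (j : B →ₐ[ℂ] T) h a b

section ContinuousMap

variable (X Y : Type*) [TopologicalSpace X] [CStarAlgebra Y]

/-- The embedding `f ↦ f(·)1` of the scalar functions. -/
def scalarHom : C(X, ℂ) →⋆ₐ[ℂ] C(X, Y) :=
  ContinuousMap.compStarAlgHom X (StarAlgHom.ofId ℂ Y) (continuous_algebraMap ℂ Y)

theorem commute_scalarHom_constHom (f : C(X, ℂ)) (b : Y) :
    Commute (scalarHom X Y f) (constHom X Y b) :=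
  ContinuousMap.ext fun x => Algebra.commutes (f x) b

variable [CompactSpace X]

/-- The canonical map from the algebraic tensor product `C(X) ⊗ Y` to `C(X, Y)`. -/
def tensorToContinuousMap : C(X, ℂ) ⊗[ℂ] Y →⋆ₐ[ℂ] C(X, Y) :=
  starTensorLift (scalarHom X Y) (constHom X Y) (commute_scalarHom_constHom X Y)

variable {X Y}

theorem tensorToContinuousMap_tmul_apply (f : C(X, ℂ)) (b : Y) (x : X) :
    tensorToContinuousMap X Y (f ⊗ₜ b) x = f x • b := by
  rw [tensorToContinuousMap, starTensorLift_tmul]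
  exact (Algebra.smul_def (f x) b).symm

theorem tensorToContinuousMap_injective : Function.Injective (tensorToContinuousMap X Y) := by
  rw [injective_iff_map_eq_zero]
  intro t ht
  obtain ⟨c, rfl⟩ := TensorProduct.eq_repr_basis_right (Module.Basis.ofVectorSpace ℂ Y) t
  set B := Module.Basis.ofVectorSpace ℂ Y
  suffices hc : c = 0 by rw [hc, Finsupp.sum_zero_index]
  ext i x
  have hsum : ∑ i ∈ c.support, c i x • B i = 0 := by
    simpa only [Finsupp.sum, map_sum, ContinuousMap.sum_apply, tensorToContinuousMap_tmul_apply,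
      ContinuousMap.zero_apply] using DFunLike.congr_fun ht x
  by_cases hi : i ∈ c.support
  · exact linearIndependent_iff'.1 B.linearIndependent c.support (fun i => c i x) hsum i hi
  · rw [Finsupp.notMem_support_iff.1 hi, Finsupp.zero_apply]

end ContinuousMap

variable {X Y : Type*} [TopologicalSpace X] [DiscreteTopology X] [CStarAlgebra Y]

theorem tensorToContinuousMap_pointMass_tmul (x : X) (b : Y) :
    tensorToContinuousMap (OnePoint X) Y (pointMass x 1 ⊗ₜ b) = pointMass x b := by
  ext z
  rw [tensorToContinuousMap_tmul_apply]
  rcases eq_or_ne z x with rfl | hz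
  · rw [pointMass_apply_self, pointMass_apply_self, one_smul]
  · rw [pointMass_apply_of_ne hz, pointMass_apply_of_ne hz, zero_smul]

theorem comp_collapseToInfty_mem_range (s : Finset X) (f : C(OnePoint X, Y)) :
    ContinuousMap.compStarAlgHom' ℂ Y (collapseToInfty (s : Set X)ᶜ) f ∈
      (tensorToContinuousMap (OnePoint X) Y).range := by
  refine ⟨1 ⊗ₜ f ∞ + ∑ x ∈ s, pointMass x 1 ⊗ₜ (f x - f ∞), ?_⟩
  refine Eq.trans ?_ (comp_collapseToInfty_compl_eq f s).symm
  change tensorToContinuousMap (OnePoint X) Y _ = _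
  rw [map_add, map_sum]
  simp only [tensorToContinuousMap_pointMass_tmul]
  congr 1
  ext z
  rw [tensorToContinuousMap_tmul_apply, ContinuousMap.one_apply, one_smul,
    ContinuousMap.const_apply]

theorem denseRange_tensorToContinuousMap :
    DenseRange (tensorToContinuousMap (OnePoint X) Y) := fun f =>
  mem_closure_of_tendsto (tendsto_comp_collapseToInfty_compl f)
    (.of_forall fun s => comp_collapseToInfty_mem_range s f)

variable (X Y) in
theorem isCStarTensorProduct_continuousMap :
    IsCStarTensorProduct (scalarHom (OnePoint X) Y) (constHom (OnePoint X) Y) where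
  commute := commute_scalarHom_constHom _ Y
  injective := tensorToContinuousMap_injective
  dense := denseRange_tensorToContinuousMap

/-- For finite `s` the functions which are constant off `s` lie in the algebraic tensor product
`C(OnePoint X) ⊗ Y`; this is `f ↦ f.comp (collapseToInfty sᶜ)` as a map into it. -/
def collapseToTensor (s : Finset X) : C(OnePoint X, Y) →⋆ₐ[ℂ] C(OnePoint X, ℂ) ⊗[ℂ] Y :=
  StarAlgHom.comp
    (StarAlgEquiv.ofInjective (tensorToContinuousMap (OnePoint X) Y)
      tensorToContinuousMap_injective).symm
    (StarAlgHom.codRestrict _ _ (comp_collapseToInfty_mem_range s))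

theorem tensorToContinuousMap_collapseToTensor (s : Finset X) (f : C(OnePoint X, Y)) :
    tensorToContinuousMap (OnePoint X) Y (collapseToTensor s f) =
      f.comp (collapseToInfty (s : Set X)ᶜ) :=
  congrArg Subtype.val ((StarAlgEquiv.ofInjective (tensorToContinuousMap (OnePoint X) Y)
    tensorToContinuousMap_injective).apply_symm_apply ⟨_, comp_collapseToInfty_mem_range s f⟩)

theorem collapseToTensor_tensorToContinuousMap_tmul (s : Finset X) (f : C(OnePoint X, ℂ)) (b : Y) :
    collapseToTensor s (tensorToContinuousMap (OnePoint X) Y (f ⊗ₜ b)) =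
      f.comp (collapseToInfty (s : Set X)ᶜ) ⊗ₜ b := by
  apply tensorToContinuousMap_injective
  rw [tensorToContinuousMap_collapseToTensor]
  ext z
  rw [ContinuousMap.comp_apply, tensorToContinuousMap_tmul_apply, tensorToContinuousMap_tmul_apply,
    ContinuousMap.comp_apply]

namespace IsCStarTensorProduct

/-- The canonical map from the algebraic tensor product to a C*-tensor product. -/
def lift {A B T : Type*} [CStarAlgebra A] [CStarAlgebra B] [CStarAlgebra T] {i : A →⋆ₐ[ℂ] T}
    {j : B →⋆ₐ[ℂ] T} (h : IsCStarTensorProduct i j) : A ⊗[ℂ] B →⋆ₐ[ℂ] T :=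
  starTensorLift i j h.commute

variable {T : Type*} [CStarAlgebra T] {i : C(OnePoint X, ℂ) →⋆ₐ[ℂ] T} {j : Y →⋆ₐ[ℂ] T}

theorem tendsto_lift_collapseToTensor (h : IsCStarTensorProduct i j)
    (t : C(OnePoint X, ℂ) ⊗[ℂ] Y) :
    Tendsto (fun s : Finset X => h.lift (collapseToTensor s (tensorToContinuousMap _ Y t))) atTop
      (𝓝 (h.lift t)) := by
  induction t with
  | zero => simpa only [map_zero] using tendsto_const_nhds
  | tmul f b =>
    simp only [collapseToTensor_tensorToContinuousMap_tmul, lift, starTensorLift_tmul]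
    exact (((map_continuous i).tendsto f).comp (tendsto_comp_collapseToInfty_compl f)).mul_const _
  | add s t hs ht => simpa only [map_add] using hs.add ht

theorem norm_lift_le (h : IsCStarTensorProduct i j) (t : C(OnePoint X, ℂ) ⊗[ℂ] Y) :
    ‖h.lift t‖ ≤ ‖tensorToContinuousMap _ Y t‖ :=
  le_of_tendsto (h.tendsto_lift_collapseToTensor t).norm <| .of_forall fun s =>
    NonUnitalStarAlgHom.norm_apply_le (h.lift.comp (collapseToTensor s)) _

theorem injective_of_forall_apply_tensorToContinuousMap [NoncompactSpace X]
    (h : IsCStarTensorProduct i j) {g : C(OnePoint X, Y) →⋆ₐ[ℂ] T}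
    (hg : ∀ t, g (tensorToContinuousMap _ Y t) = h.lift t) : Function.Injective g := by
  rw [injective_iff_map_eq_zero]
  intro f hf
  refine ext_of_forall_coe fun x => ?_
  have hpoint : h.lift (pointMass x 1 ⊗ₜ f x) = 0 := by
    rw [← hg, tensorToContinuousMap_pointMass_tmul, ← one_mul (f x), ← pointMass_mul, map_mul, hf,
      mul_zero]
  have htensor : (pointMass x 1 ⊗ₜ f x : C(OnePoint X, ℂ) ⊗[ℂ] Y) = 0 :=
    h.injective (hpoint.trans (map_zero h.lift).symm)
  rw [← pointMass_apply_self x (f x), ← tensorToContinuousMap_pointMass_tmul, htensor, map_zero]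

theorem exists_equiv [NoncompactSpace X] (h : IsCStarTensorProduct i j) :
    ∃ e : T ≃⋆ₐ[ℂ] C(OnePoint X, Y),
      (∀ f, e (i f) = scalarHom _ Y f) ∧ ∀ b, e (j b) = constHom _ Y b := by
  obtain ⟨g, hg⟩ := exists_starAlgHom_of_denseRange (F := C(OnePoint X, Y))
    denseRange_tensorToContinuousMap h.norm_lift_le
  have hinj := h.injective_of_forall_apply_tensorToContinuousMap hg
  have hrange : Set.range h.lift ⊆ Set.range g := Set.range_subset_iff.2 fun t => ⟨_, hg t⟩
  have hbij : Function.Bijective g := ⟨hinj, fun a => closure_minimal hrange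
    (NonUnitalStarAlgHom.isometry g hinj).isClosedEmbedding.isClosed_range (h.dense a)⟩
  have hgmul (f : C(OnePoint X, ℂ)) (b : Y) :
      g (scalarHom _ Y f * constHom _ Y b) = i f * j b := by
    rw [← starTensorLift_tmul (commute_scalarHom_constHom _ Y)]
    exact (hg _).trans (starTensorLift_tmul h.commute f b)
  refine ⟨(StarAlgEquiv.ofBijective g hbij).symm, fun f => ?_, fun b => ?_⟩ <;>
    rw [StarAlgEquiv.symm_apply_eq, StarAlgEquiv.ofBijective_apply]
  · simpa only [map_one, mul_one] using (hgmul f 1).symm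
  · simpa only [map_one, one_mul] using (hgmul 1 b).symm

end IsCStarTensorProduct

end TensorProduct

section RankOne

theorem exists_finiteDimensional_norm_sub_comp_le {𝕜 E F : Type*} [RCLike 𝕜]
    [SeminormedAddCommGroup E] [NormedSpace 𝕜 E] [NormedAddCommGroup F] [InnerProductSpace 𝕜 F]
    {T : E →L[𝕜] F} (hT : IsCompactOperator T) {ε : ℝ} (hε : 0 < ε) :
    ∃ (U : Submodule 𝕜 F) (_ : FiniteDimensional 𝕜 U), ‖T - U.starProjection ∘L T‖ ≤ ε := by
  have hball : TotallyBounded (T '' Metric.closedBall 0 1) :=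
    (hT.isCompact_closure_image_closedBall (f := (T : E →ₗ[𝕜] F)) 1).totallyBounded.subset
      subset_closure
  obtain ⟨s, -, hs, hcover⟩ := Metric.finite_approx_of_totallyBounded hball ε hε
  have : FiniteDimensional 𝕜 (Submodule.span 𝕜 s) := .span_of_finite 𝕜 hs
  refine ⟨Submodule.span 𝕜 s, this, ContinuousLinearMap.opNorm_le_of_unit_norm hε.le ?_⟩
  intro x hx
  have hTx := hcover (Set.mem_image_of_mem T (mem_closedBall_zero_iff.2 hx.le))
  simp only [Set.mem_iUnion, exists_prop] at hTx
  obtain ⟨y, hy, hxy⟩ := hTx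
  have hproj : (T - (Submodule.span 𝕜 s).starProjection ∘L T) x =
      (Submodule.span 𝕜 s)ᗮ.starProjection (T x - y) := by
    rw [Submodule.starProjection_orthogonal']
    simp [Submodule.starProjection_eq_self_iff.2 (Submodule.subset_span hy)]
  calc ‖(T - (Submodule.span 𝕜 s).starProjection ∘L T) x‖
      ≤ 1 * ‖T x - y‖ := hproj ▸ ContinuousLinearMap.le_of_opNorm_le _
        (Submodule.starProjection_norm_le _) _
    _ ≤ ε := by rw [one_mul, ← dist_eq_norm]; exact (Metric.mem_ball.1 hxy).le

variable {H : Type*} [NormedAddCommGroup H] [InnerProductSpace ℂ H]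
  {S : Submodule ℂ (H →L[ℂ] H)}

theorem isCompactOperator_rankOne (x y : H) : IsCompactOperator (rankOne ℂ x y) :=
  isCompactOperator_of_forall_mem_span fun _ =>
    Submodule.smul_mem _ _ (Submodule.mem_span_singleton_self x)

theorem isMinimalProjection_rankOne_self [CompleteSpace H] {x : H} (hx : ‖x‖ = 1) :
    IsMinimalProjection (rankOne ℂ x x) := by
  have hx0 : x ≠ 0 := norm_ne_zero_iff.1 (hx ▸ one_ne_zero)
  have hp := isStarProjection_rankOne_self (𝕜 := ℂ) hx
  refine isMinimalProjection_iff.2 ⟨rankOne_ne_zero hx0 hx0, hp,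
    fun T => ⟨inner ℂ x (T x), ?_⟩⟩
  ext z
  simp only [mul_apply_eq_comp, rankOne_apply, map_smul, smul_apply, smul_smul,
    mul_comm]

theorem rankOne_self_mem (h : ∀ x : H, ‖x‖ = 1 → rankOne ℂ x x ∈ S) (x : H) :
    rankOne ℂ x x ∈ S := by
  rcases eq_or_ne x 0 with rfl | hx
  · simp
  obtain ⟨r, n, hn, rfl⟩ : ∃ (r : ℂ) (n : H), ‖n‖ = 1 ∧ x = r • n :=
    ⟨‖x‖, NormedSpace.normalize x, NormedSpace.norm_normalize hx, by
      rw [Complex.coe_smul, NormedSpace.norm_smul_normalize]⟩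
  simpa only [map_smulₛₗ, smul_apply] using S.smul_mem _ (S.smul_mem _ (h n hn))

theorem rankOne_mem (h : ∀ x : H, ‖x‖ = 1 → rankOne ℂ x x ∈ S) (x y : H) :
    rankOne ℂ x y ∈ S := by
  have hsymm (x y : H) : rankOne ℂ x y + rankOne ℂ y x ∈ S := by
    convert S.sub_mem (S.sub_mem (rankOne_self_mem h (x + y)) (rankOne_self_mem h x))
      (rankOne_self_mem h y) using 1
    simp only [map_add, add_apply]
    abel
  convert S.smul_mem (2⁻¹ : ℂ) (S.add_mem (hsymm x y)
    (S.smul_mem Complex.I (hsymm x (Complex.I • y)))) using 1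
  ext z
  simp only [map_smulₛₗ, RingHom.id_apply, Complex.conj_I, smul_apply, add_apply, rankOne_apply]
  match_scalars
  · linear_combination (2⁻¹ * inner ℂ y z) * Complex.I_sq
  · linear_combination (-2⁻¹ * inner ℂ x z) * Complex.I_sq

theorem mem_of_isCompactOperator [CompleteSpace H] (hS : IsClosed (S : Set (H →L[ℂ] H)))
    (h : ∀ x : H, ‖x‖ = 1 → rankOne ℂ x x ∈ S) {T : H →L[ℂ] H} (hT : IsCompactOperator T) :
    T ∈ S := by
  rw [← SetLike.mem_coe, ← hS.closure_eq]
  refine Metric.mem_closure_iff.2 fun ε hε => ?_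
  obtain ⟨U, _, hU⟩ := exists_finiteDimensional_norm_sub_comp_le hT (half_pos hε)
  refine ⟨U.starProjection ∘L T, ?_, by rw [dist_eq_norm]; exact hU.trans_lt (half_lt_self hε)⟩
  rw [(stdOrthonormalBasis ℂ U).starProjection_eq_sum_rankOne,
    ContinuousLinearMap.finsetSum_comp]
  exact S.sum_mem fun i _ => by
    rw [rankOne_comp]
    exact rankOne_mem h _ _

end RankOne

section UnitizedCompacts

variable {H : Type u} [NormedAddCommGroup H] [InnerProductSpace ℂ H] [CompleteSpace H]

/-- The unitization of `K(H)`; for infinite-dimensional `H` it is the algebra `K(H) + ℂ 1`. -/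
abbrev UnitizedCompactOperators (H : Type*) [NormedAddCommGroup H] [InnerProductSpace ℂ H]
    [CompleteSpace H] : Type _ :=
  Unitization ℂ (compactOperators H)

variable (H) in
/-- The character of the unitization of `K(H)` with kernel `K(H)`. -/
def scalarPart : UnitizedCompactOperators H →⋆ₐ[ℂ] ℂ := Unitization.starLift 0

variable (H) in
/-- The tautological representation of the unitization of `K(H)` on `H`. -/
def unitizationRep : UnitizedCompactOperators H →⋆ₙₐ[ℂ] (H →L[ℂ] H) :=
  NonUnitalStarSubalgebra.unitization (compactOperators H)

theorem scalarPart_apply (b : UnitizedCompactOperators H) : scalarPart H b = b.fst :=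
  add_zero b.fst

theorem unitizationRep_apply (b : UnitizedCompactOperators H) :
    unitizationRep H b = scalarPart H b • (1 : H →L[ℂ] H) + (b.snd : H →L[ℂ] H) := by
  rw [scalarPart_apply, ← Algebra.algebraMap_eq_smul_one]
  exact NonUnitalStarSubalgebra.unitization_apply (compactOperators H) b

theorem unitizationRep_inr (k : compactOperators H) :
    unitizationRep H (k : UnitizedCompactOperators H) = k := by
  simp [unitizationRep_apply, scalarPart_apply]

theorem isCompactOperator_unitizationRep {b : UnitizedCompactOperators H}
    (hb : scalarPart H b = 0) : IsCompactOperator (unitizationRep H b) := by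
  rw [unitizationRep_apply, hb, zero_smul, zero_add]
  exact b.snd.2

theorem one_notMem_compactOperators (hH : ¬ FiniteDimensional ℂ H) : 1 ∉ compactOperators H :=
  fun h => hH (.of_isCompactOperator_id (𝕜 := ℂ) h)

theorem unitizationRep_injective (hH : ¬ FiniteDimensional ℂ H) :
    Function.Injective (unitizationRep H) :=
  NonUnitalStarSubalgebra.unitization_injective _ (one_notMem_compactOperators hH)

theorem isIrreducibleRep_unitizationRep [Nontrivial H] : IsIrreducibleRep (unitizationRep H) := by
  refine ⟨fun h => one_ne_zero (α := H →L[ℂ] H) ?_,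
    fun S _ hS => or_iff_not_imp_left.2 fun hbot => ?_⟩
  · simpa [unitizationRep_apply] using DFunLike.congr_fun h 1
  · obtain ⟨z, hz, hz0⟩ := Submodule.exists_mem_ne_zero_of_ne_bot hbot
    refine Submodule.eq_top_iff'.2 fun y => ?_
    have hy := hS (⟨rankOne ℂ y z, isCompactOperator_rankOne y z⟩ : compactOperators H) z hz
    rw [unitizationRep_inr] at hy
    exact (S.smul_mem_iff (inner_self_ne_zero.2 hz0)).1 hy

variable (hH : ¬ FiniteDimensional ℂ H)
include hH

theorem scalarPart_eq_zero_of_mem_ccrIdeal {b : UnitizedCompactOperators H}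
    (hb : b ∈ ccrIdeal _) : scalarPart H b = 0 := by
  by_contra h0
  have : Nontrivial H := not_subsingleton_iff_nontrivial.1 fun _ => hH inferInstance
  have hscalar : scalarPart H b • (1 : H →L[ℂ] H) ∈ compactOperators H := by
    rw [← add_sub_cancel_right (scalarPart H b • (1 : H →L[ℂ] H)) b.snd, ← unitizationRep_apply]
    exact sub_mem (hb H _ isIrreducibleRep_unitizationRep) b.snd.2
  refine one_notMem_compactOperators hH ?_
  simpa [h0] using (compactOperators H).smul_mem (scalarPart H b)⁻¹ hscalar

theorem one_notMem_ccrIdeal : 1 ∉ ccrIdeal (UnitizedCompactOperators H) := fun h =>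
  one_ne_zero ((map_one (scalarPart H)).symm.trans (scalarPart_eq_zero_of_mem_ccrIdeal hH h))

theorem isMinimalProjection_inr_rankOne_self {x : H} (hx : ‖x‖ = 1) :
    IsMinimalProjection
      ((⟨rankOne ℂ x x, isCompactOperator_rankOne x x⟩ : compactOperators H) :
        UnitizedCompactOperators H) :=
  .of_map (unitizationRep H) (unitizationRep_injective hH) <| by
    rw [unitizationRep_inr]
    exact isMinimalProjection_rankOne_self hx

theorem exists_isMinimalProjection_unitizedCompactOperators :
    ∃ q : UnitizedCompactOperators H, IsMinimalProjection q :=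
  have : Nontrivial H := not_subsingleton_iff_nontrivial.1 fun _ => hH inferInstance
  let ⟨_, hx⟩ := exists_norm_eq H zero_le_one
  ⟨_, isMinimalProjection_inr_rankOne_self hH hx⟩

theorem mem_atomIdeal_of_scalarPart_eq_zero {b : UnitizedCompactOperators H}
    (hb : scalarPart H b = 0) : b ∈ atomIdeal (UnitizedCompactOperators H) := by
  let S : NonUnitalStarSubalgebra ℂ (UnitizedCompactOperators H) :=
    (NonUnitalStarAlgebra.adjoin ℂ {p | IsMinimalProjection p}).topologicalClosure
  have hS : IsClosed (S.map (unitizationRep H) : Set (H →L[ℂ] H)) := by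
    rw [NonUnitalStarSubalgebra.coe_map]
    exact (NonUnitalStarAlgHom.isometry _
      (unitizationRep_injective hH)).isClosedEmbedding.isClosedMap _ isClosed_closure
  have hrank (x : H) (hx : ‖x‖ = 1) : rankOne ℂ x x ∈ S.map (unitizationRep H) :=
    ⟨_, (isMinimalProjection_inr_rankOne_self hH hx).mem_atomIdeal, unitizationRep_inr _⟩
  obtain ⟨a, ha, hab⟩ : unitizationRep H b ∈ S.map (unitizationRep H) :=
    mem_of_isCompactOperator (S := (S.map (unitizationRep H)).toSubmodule) hS hrank
      (isCompactOperator_unitizationRep hb)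
  exact unitizationRep_injective hH hab ▸ ha

theorem isScattered_unitizedCompactOperators : IsScattered (UnitizedCompactOperators H) :=
  .of_starKer (scalarPart H : UnitizedCompactOperators H →⋆ₙₐ[ℂ] ℂ) isScattered_complex <|
    isScattered_of_isCompactOperator
      (ρ := (unitizationRep H).comp (NonUnitalStarSubalgebraClass.subtype _))
      ((unitizationRep_injective hH).comp Subtype.val_injective)
      fun b => isCompactOperator_unitizationRep (mem_starKer.1 b.2)

theorem atomIdeal_unitizedCompactOperators :
    atomIdeal (UnitizedCompactOperators H) = {b | scalarPart H b = 0} :=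
  have hker : atomIdeal (UnitizedCompactOperators H) ⊆
      starKer (scalarPart H : UnitizedCompactOperators H →⋆ₙₐ[ℂ] ℂ) :=
    atomIdeal_subset (isClosed_starKer _) fun _ hp =>
      mem_starKer.2 (scalarPart_eq_zero_of_mem_ccrIdeal hH hp.mem_ccrIdeal)
  Set.Subset.antisymm (fun _ hb => mem_starKer.1 (hker hb))
    fun _ => mem_atomIdeal_of_scalarPart_eq_zero hH

end UnitizedCompacts

theorem not_finiteDimensional_ellTwo : ¬ FiniteDimensional ℂ EllTwo := fun _ =>
  have := (HilbertBasis.ofRepr (.refl ℂ EllTwo)).orthonormal.linearIndependent.finite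
  not_finite ℕ

theorem mainTheorem11_general {X H : Type u} [TopologicalSpace X] [DiscreteTopology X] [Infinite X]
    [NormedAddCommGroup H] [InnerProductSpace ℂ H] [CompleteSpace H]
    (hH : ¬ FiniteDimensional ℂ H) :
    (∃ (i : C(OnePoint X, ℂ) →⋆ₐ[ℂ] C(OnePoint X, UnitizedCompactOperators H))
      (j : UnitizedCompactOperators H →⋆ₐ[ℂ] C(OnePoint X, UnitizedCompactOperators H)),
      (∀ f x, i f x = algebraMap ℂ (UnitizedCompactOperators H) (f x)) ∧ (∀ b x, j b x = b) ∧
      IsCStarTensorProduct (A := C(OnePoint X, ℂ)) (B := UnitizedCompactOperators H)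
        (T := C(OnePoint X, UnitizedCompactOperators H)) i j ∧
      ∀ (T : Type*) [CStarAlgebra T] (i' : C(OnePoint X, ℂ) →⋆ₐ[ℂ] T)
        (j' : UnitizedCompactOperators H →⋆ₐ[ℂ] T),
        IsCStarTensorProduct (A := C(OnePoint X, ℂ)) (B := UnitizedCompactOperators H) i' j' →
        ∃ e : T ≃⋆ₐ[ℂ] C(OnePoint X, UnitizedCompactOperators H),
          (∀ f, e (i' f) = i f) ∧ ∀ b, e (j' b) = j b) ∧
    IsScattered C(OnePoint X, UnitizedCompactOperators H) ∧
    (∃ I, IsCantorBendixsonSequence C(OnePoint X, UnitizedCompactOperators H) 3 I) ∧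
    ∀ θ I, IsCantorBendixsonSequence C(OnePoint X, UnitizedCompactOperators H) θ I →
      θ = 3 ∧ ∀ α ≤ θ, I α ≠ ccrIdeal C(OnePoint X, UnitizedCompactOperators H) := by
  have : NoncompactSpace X := not_compactSpace_iff.1 fun _ =>
    not_finite_iff_infinite.2 ‹_› finite_of_compact_of_discrete
  obtain ⟨q, hq⟩ := exists_isMinimalProjection_unitizedCompactOperators hH
  have hσ := atomIdeal_unitizedCompactOperators hH
  exact ⟨⟨scalarHom _ _, constHom _ _, fun _ _ => rfl, fun _ _ => rfl,
      isCStarTensorProduct_continuousMap _ _, fun T _ i' j' h => h.exists_equiv⟩,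
    (isScattered_unitizedCompactOperators hH).continuousMap_onePoint,
    ⟨_, isCantorBendixsonSequence_derivedIdeal hσ hq⟩,
    fun θ I hI => hI.height_eq_three_and_forall_ne_ccrIdeal hσ hq (one_notMem_ccrIdeal hH)⟩

end

theorem mainTheorem11 :
    -- `C(ω + 1, K(ℓ₂)~)` is the C*-tensor product `C(ω + 1) ⊗ K(ℓ₂)~`
    (∃ (i : C(OmegaPlusOne, ℂ) →⋆ₐ[ℂ] ExampleAlgebra) (j : UnitizedCompacts →⋆ₐ[ℂ] ExampleAlgebra),
      (∀ f x, i f x = algebraMap ℂ UnitizedCompacts (f x)) ∧ (∀ b x, j b x = b) ∧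
      IsCStarTensorProduct (A := C(OmegaPlusOne, ℂ)) (B := UnitizedCompacts) (T := ExampleAlgebra) i j ∧
      ∀ (T : Type) [CStarAlgebra T] (i' : C(OmegaPlusOne, ℂ) →⋆ₐ[ℂ] T)
        (j' : UnitizedCompacts →⋆ₐ[ℂ] T), IsCStarTensorProduct (A := C(OmegaPlusOne, ℂ)) (B := UnitizedCompacts) (T := T) i' j' →
        ∃ e : T ≃⋆ₐ[ℂ] ExampleAlgebra, (∀ f, e (i' f) = i f) ∧ ∀ b, e (j' b) = j b) ∧
    -- it is scattered
    IsScattered ExampleAlgebra ∧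
    -- it has a Cantor–Bendixson sequence, of height 3
    (∃ I : Ordinal.{0} → ClosedIdeal ExampleAlgebra,
      IsCantorBendixsonSequence ExampleAlgebra 3 I) ∧
    -- in the Cantor–Bendixson sequence, whose height is 3, the ideal `CCR` does not appear
    ∀ (θ : Ordinal.{0}) (I : Ordinal.{0} → ClosedIdeal ExampleAlgebra),
      IsCantorBendixsonSequence ExampleAlgebra θ I →
        θ = 3 ∧ ∀ α ≤ θ, I α ≠ ccrIdeal ExampleAlgebra :=
  mainTheorem11_general (X := ℕ) (H := EllTwo) not_finiteDimensional_ellTwo
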